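/- **Setting.** A warehouse is a rectilinear grid of length $L\ge 0$ and width $W\ge 0$ with $a\ge 1$ equidistant parallel aisles (segments of length $W$) and $b\ge 2$ equidistant cross-aisles (segments of length $L$), the outer ones bounding the grid; $d$ is the shortest-path distance in this network and the depot $l_d$ is a point of it. A single picker walks at unit speed, starts at the depot at time $0$, and has a cart with $c\ge 1$ bins; picking takes no time. An instance $I(n)$ consists of orders $o_1,\dots,o_n$, each a nonempty finite set of picking locations in the aisles, and arrival times $0\le r_1\le\dots\le r_n$. Orders are collected in successive batches of at most $c$ orders; an order may not be split between batches, and no item of $o_j$ can be picked before $r_j$. With a *pushcart*, the picker returns to the depot at the end of each batch, and the completion time is the time of the last return; with a *robot*, she starts the next batch where the previous one ended, and the completion time is the time of the last pick. $CIOPT(I)$ is the least completion time over all choices of batches, sequence of batches and visiting sequences within the batches when the whole instance is known in advance. $Reopt(I)$ is the completion time of the following online policy, where ties between optimal plans and between shortest routes are broken arbitrarily. In *Pcart-N* (pushcart), whenever the picker is at the depot and newly arrived orders are available, a plan of minimal completion time is computed for all orders that have arrived and are not yet picked, treated as immediately available; started batches are never changed, and when nothing is left to do she waits at the depot. In *Pcart*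 (pushcart) and *Robot* (robot), at every arrival of a new order a plan of minimal completion time is computed for all items that belong to arrived orders and are not yet picked, starting from the current position of the picker; orders that have picked items in the current cart must be completed in the current batch, and its empty bins may be (re)assigned to any order not yet commenced. **Theorem.** Let $O_1,O_2,\dots$ be i.i.d. random orders, $O_j=(K_j,S_j^1,\dots,S_j^{K_j})$ with $K_j\ge 1$, and let $Y_1,Y_2,\dots\ge 0$ be i.i.d. random variables with finite mean such that the sequences $(O_j)_j$ and $(Y_j)_j$ are independent. Let $I(n)$ be the random instance with orders $O_1,\dots,O_n$ and arrival times $R_j=Y_{(j)}$, where $Y_{(1)}\le\dots\le Y_{(n)}$ are the order statistics of $Y_1,\dots,Y_n$. Assume that it is not the case that almost surely $Y_1=0$ and all picking locations of $O_1$ are at the depot; in *Robot*, assume also that the expected number of distinct picking locations of $O_1$ is larger than $1$. Then, in each of the systems *Pcart-N*, *Pcart* and *Robot*, $Reopt(I(n))$ is well defined for every $n$ almost surely, and, however ties are broken, $$\lim_{n\to\infty}\frac{Reopt(I(n))}{CIOPT(I(n))}=1\qquad\text{almost surely.}$$ -/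

import Mathlib

open MeasureTheory ProbabilityTheory Filter Topology
open scoped ENNReal

noncomputable section

namespace OrderPicking

/-- A point of the floor plan. The first coordinate runs along the cross-aisles (the length of the
warehouse), the second one along the aisles (its width). -/
abbrev Pt := ℝ × ℝ

/-- A rectilinear warehouse of length `len` and width `wid` with `a ≥ 1` equidistant parallel aisles
and `b ≥ 2` equidistant cross-aisles; the outer ones bound the warehouse. -/
structure Warehouse where
  len : ℝ
  wid : ℝ
  a : ℕ
  b : ℕ
  depot : Pt
  len_nonneg : 0 ≤ len
  wid_nonneg : 0 ≤ wid
  one_le_a : 1 ≤ a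
  two_le_b : 2 ≤ b
  /-- The depot lies in an aisle or in a cross-aisle. -/
  depot_mem :
    ((∃ i < a, depot.1 = i * (len / (a - 1))) ∧ 0 ≤ depot.2 ∧ depot.2 ≤ wid) ∨
    ((∃ k < b, depot.2 = k * (wid / (b - 1))) ∧ 0 ≤ depot.1 ∧ depot.1 ≤ len)

namespace Warehouse

variable (w : Warehouse)

/-- The point lies in one of the aisles (a single aisle, `a = 1`, has first coordinate `0`). -/
def OnAisle (p : Pt) : Prop :=
  (∃ i < w.a, p.1 = i * (w.len / (w.a - 1))) ∧ 0 ≤ p.2 ∧ p.2 ≤ w.wid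

/-- The point lies in one of the cross-aisles. -/
def OnCross (p : Pt) : Prop :=
  (∃ k < w.b, p.2 = k * (w.wid / (w.b - 1))) ∧ 0 ≤ p.1 ∧ p.1 ≤ w.len

/-- The positions that the picker can take. -/
def Walkable (p : Pt) : Prop := w.OnAisle p ∨ w.OnCross p

/-- A straight walk from `p` to `q` within one aisle or within one cross-aisle. -/
def Straight (p q : Pt) : Prop :=
  (w.OnAisle p ∧ w.OnAisle q ∧ p.1 = q.1) ∨ (w.OnCross p ∧ w.OnCross q ∧ p.2 = q.2)

/-- `Route p q ℓ`: there is a walk of length `ℓ` from `p` to `q` through aisles and cross-aisles. -/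
inductive Route : Pt → Pt → ℝ → Prop
  | refl (p : Pt) (hp : w.Walkable p) : Route p p 0
  | cons (p q s : Pt) (ℓ : ℝ) (hpq : w.Straight p q) (hqs : Route q s ℓ) :
      Route p s (|p.1 - q.1| + |p.2 - q.2| + ℓ)

/-- The walking distance in the warehouse: the length of a shortest route. -/
def d (p q : Pt) : ℝ := sInf {ℓ | w.Route p q ℓ}

end Warehouse

/-- The three picking systems: pushcart with noninterventionist reoptimization, pushcart with
interventionist reoptimization, robot with interventionist reoptimization. -/
inductive PickingSystem
  | pcartN
  | pcart
  | robot

/-- An item to be collected: the index of its order and its picking location. -/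
abbrev Item (n : ℕ) := Fin n × Pt

/-- A picking tour: the items of a batch in the sequence in which they are collected. -/
abbrev Tour (n : ℕ) := List (Item n)

/-- The orders that occur in a tour. -/
def ordersOf {n : ℕ} (B : Tour n) : Finset (Fin n) := (B.map Prod.fst).toFinset

/-- The data of `n` orders: the sets of picking locations and the arrival times. -/
structure Instance (n : ℕ) where
  locs : Fin n → Finset Pt
  arr : Fin n → ℝ

namespace Instance

variable {n : ℕ} (I : Instance n)

/-- All items of the orders in `A`. -/
def itemsOf (A : Finset (Fin n)) : Set (Item n) := {x | x.1 ∈ A ∧ x.2 ∈ I.locs x.1}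

/-- The orders that have arrived by time `t`. -/
def arrived (t : ℝ) : Finset (Fin n) := Finset.univ.filter fun k => I.arr k ≤ t

/-- `k` is one of the first arrivals outside `A`. -/
def IsNext (A : Finset (Fin n)) (k : Fin n) : Prop := k ∉ A ∧ ∀ m, m ∉ A → I.arr k ≤ I.arr m

end Instance

section Planning

variable (w : Warehouse) (sys : PickingSystem) (c : ℕ)

/-- Where the picker ends a batch whose last item is at `p`: a pushcart has to be brought to the
depot, a robot leaves the picker where she is. -/
def batchEnd (p : Pt) : Pt :=
  match sys with
  | .pcartN => w.depot
  | .pcart => w.depot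
  | .robot => p

/-- Position and time after collecting the items of a tour, each as early as possible, starting at
the given position and time; an item cannot be collected before the arrival of its order. -/
def serve {n : ℕ} (arr : Fin n → ℝ) : Tour n → Pt × ℝ → Pt × ℝ
  | [], s => s
  | x :: B, s => serve arr B (x.2, max (s.2 + w.d s.1 x.2) (arr x.1))

/-- Position and time after serving a tour and ending the batch. -/
def serveBatch {n : ℕ} (arr : Fin n → ℝ) (s : Pt × ℝ) (B : Tour n) : Pt × ℝ :=
  let e := serve w arr B s
  (batchEnd w sys e.1, e.2 + w.d e.1 (batchEnd w sys e.1))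

/-- The time at which a sequence of batches is completed. -/
def completion {n : ℕ} (arr : Fin n → ℝ) (s : Pt × ℝ) (P : List (Tour n)) : ℝ :=
  (P.foldl (serveBatch w sys arr) s).2

/-- A solution for the set `Q` of items: a sequence of batches, each with at most `c` orders and with
a visiting sequence of its items, such that no order is split between batches. -/
structure IsPlan {n : ℕ} (Q : Set (Item n)) (P : List (Tour n)) : Prop where
  nodup : P.flatten.Nodup
  cover : ∀ x, x ∈ P.flatten ↔ x ∈ Q
  nonempty : ∀ B ∈ P, B ≠ []
  capacity : ∀ B ∈ P, (ordersOf B).card ≤ c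
  unsplit : P.Pairwise fun B B' => Disjoint (ordersOf B) (ordersOf B')

/-- The complete-information optimum: the least completion time, when all orders and their arrival
times are known in advance and the picker starts at the depot at time `0`. -/
def CIOPT {n : ℕ} (I : Instance n) : ℝ :=
  sInf {T | ∃ P, IsPlan c (I.itemsOf Finset.univ) P ∧ T = completion w sys I.arr (w.depot, 0) P}

/-! ### Noninterventionist reoptimization -/

/-- The picker is at the depot at time `time`; `plan` are the planned batches that have not been
started, `known` the orders that have been taken into account so far. -/
structure NState (n : ℕ) where
  time : ℝ
  plan : List (Tour n)
  known : Finset (Fin n)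

/-- `P` is an optimal solution for the items `Q`, all of them immediately available, from the depot. -/
def IsOptimalPlan {n : ℕ} (Q : Set (Item n)) (P : List (Tour n)) : Prop :=
  IsPlan c Q P ∧ ∀ P', IsPlan c Q P' →
    completion w sys (fun _ => 0) (w.depot, 0) P ≤ completion w sys (fun _ => 0) (w.depot, 0) P'

/-- One step of noninterventionist reoptimization with a pushcart. -/
inductive NStep {n : ℕ} (I : Instance n) : NState n → NState n → Prop
  /-- At the depot, with newly arrived orders: plan anew all arrived orders that are not picked. -/
  | reopt (s : NState n) (P : List (Tour n))
      (hnew : ∃ k, k ∉ s.known ∧ I.arr k ≤ s.time)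
      (hP : IsOptimalPlan w .pcartN c
        ({x | x ∈ s.plan.flatten} ∪ I.itemsOf (I.arrived s.time \ s.known)) P) :
      NStep I s ⟨s.time, P, I.arrived s.time⟩
  /-- Collect the next planned batch, without any intervention, and return to the depot. -/
  | batch (s : NState n) (B : Tour n) (P : List (Tour n)) (hs : s.plan = B :: P)
      (hold : ∀ k, k ∉ s.known → s.time ≤ I.arr k) :
      NStep I s ⟨completion w .pcartN (fun _ => 0) (w.depot, s.time) [B], P, s.known⟩
  /-- Nothing left to do: stay at the depot until the next arrival. -/
  | idle (s : NState n) (k : Fin n) (hs : s.plan = []) (hk : I.IsNext s.known k)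
      (ht : s.time < I.arr k) :
      NStep I s ⟨I.arr k, [], s.known⟩

/-- `T` is a completion time of noninterventionist reoptimization (for some choice among equally
good plans). -/
def IsNReopt {n : ℕ} (I : Instance n) (T : ℝ) : Prop :=
  Relation.ReflTransGen (NStep w c I) ⟨0, [], ∅⟩ ⟨T, [], Finset.univ⟩

/-! ### Interventionist reoptimization -/

/-- State of the interventionist policy: time, position of the picker, orders with picked items in
the current cart, remaining tour of the current batch, planned later batches, and the orders that
have been taken into account so far. -/
structure IState (n : ℕ) where
  time : ℝ
  pos : Pt
  cart : Finset (Fin n)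
  cur : Tour n
  fut : List (Tour n)
  known : Finset (Fin n)

/-- A feasible replanning for the unpicked items `Q` when the orders in `cart` occupy bins of the
current cart: those orders are completed in the current batch, whose remaining tour is `cur`, and
the empty bins can be given to any other orders. -/
structure IsReplan {n : ℕ} (cart : Finset (Fin n)) (Q : Set (Item n)) (cur : Tour n)
    (fut : List (Tour n)) : Prop where
  nodup : (cur ++ fut.flatten).Nodup
  cover : ∀ x, x ∈ cur ++ fut.flatten ↔ x ∈ Q
  commit : ∀ x ∈ Q, x.1 ∈ cart → x ∈ cur
  nonempty : ∀ B ∈ fut, B ≠ []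
  capacity_cur : (cart ∪ ordersOf cur).card ≤ c
  capacity_fut : ∀ B ∈ fut, (ordersOf B).card ≤ c
  unsplit : (cur :: fut).Pairwise fun B B' => Disjoint (ordersOf B) (ordersOf B')

/-- A feasible replanning that completes `Q` as early as possible from position `p`. -/
def IsOptimalReplan {n : ℕ} (p : Pt) (cart : Finset (Fin n)) (Q : Set (Item n)) (cur : Tour n)
    (fut : List (Tour n)) : Prop :=
  IsReplan c cart Q cur fut ∧ ∀ cur' fut', IsReplan c cart Q cur' fut' →
    completion w sys (fun _ => 0) (p, 0) (cur :: fut) ≤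
      completion w sys (fun _ => 0) (p, 0) (cur' :: fut')

namespace IState

variable {n : ℕ} (s : IState n)

/-- The next destination: the next item of the current tour, or the end of the current batch. -/
def dest : Pt :=
  match s.cur with
  | [] => batchEnd w sys s.pos
  | x :: _ => x.2

/-- Everything planned has been completed. -/
def Idle : Prop := s.cur = [] ∧ s.fut = [] ∧ s.cart = ∅ ∧ s.pos = batchEnd w sys s.pos

end IState

/-- One step of interventionist reoptimization. No step passes the arrival time of an order that
has not been taken into account. -/
inductive IStep {n : ℕ} (I : Instance n) : IState n → IState n → Prop
  /-- New orders have arrived: plan anew all arrived items that are not picked, from the current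
  position. -/
  | reopt (s : IState n) (cur : Tour n) (fut : List (Tour n))
      (hnew : ∃ k, k ∉ s.known ∧ I.arr k ≤ s.time)
      (hP : IsOptimalReplan w sys c s.pos s.cart
        ({x | x ∈ s.cur ++ s.fut.flatten} ∪ I.itemsOf (I.arrived s.time \ s.known)) cur fut) :
      IStep I s ⟨s.time, s.pos, s.cart, cur, fut, I.arrived s.time⟩
  /-- A new order arrives while the picker is on a shortest route to the next destination: at that
  moment she is at some point `p` of this route. -/
  | walk (s : IState n) (k : Fin n) (p : Pt) (hk : I.IsNext s.known k)
      (ht : s.time < I.arr k) (hd : I.arr k ≤ s.time + w.d s.pos (s.dest w sys))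
      (hp : w.Walkable p) (hp₁ : w.d s.pos p = I.arr k - s.time)
      (hp₂ : w.d s.pos p + w.d p (s.dest w sys) = w.d s.pos (s.dest w sys)) :
      IStep I s ⟨I.arr k, p, s.cart, s.cur, s.fut, s.known⟩
  /-- Collect the next item of the current tour. -/
  | pick (s : IState n) (x : Item n) (B : Tour n) (hs : s.cur = x :: B)
      (ht : ∀ k, k ∉ s.known → s.time + w.d s.pos x.2 ≤ I.arr k) :
      IStep I s ⟨s.time + w.d s.pos x.2, x.2, insert x.1 s.cart, B, s.fut, s.known⟩
  /-- End the current batch and turn to the next one. -/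
  | close (s : IState n) (hs : s.cur = []) (hni : ¬ s.Idle w sys)
      (ht : ∀ k, k ∉ s.known → s.time + w.d s.pos (batchEnd w sys s.pos) ≤ I.arr k) :
      IStep I s ⟨s.time + w.d s.pos (batchEnd w sys s.pos), batchEnd w sys s.pos, ∅,
        s.fut.headD [], s.fut.tail, s.known⟩
  /-- Nothing left to do: stay until the next arrival. -/
  | idle (s : IState n) (k : Fin n) (hs : s.Idle w sys) (hk : I.IsNext s.known k)
      (ht : s.time < I.arr k) :
      IStep I s ⟨I.arr k, s.pos, s.cart, s.cur, s.fut, s.known⟩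

/-- `T` is a completion time of interventionist reoptimization (for some choice among equally good
plans and among shortest routes). -/
def IsIReopt {n : ℕ} (I : Instance n) (T : ℝ) : Prop :=
  ∃ s : IState n, Relation.ReflTransGen (IStep w sys c I) ⟨0, w.depot, ∅, [], [], ∅⟩ s ∧
    s.Idle w sys ∧ s.known = Finset.univ ∧ s.time = T

/-- `T` is a value of `Reopt(I)` in the given picking system. -/
def IsReopt {n : ℕ} (I : Instance n) (T : ℝ) : Prop :=
  match sys with
  | .pcartN => IsNReopt w c I T
  | .pcart => IsIReopt w .pcart c I T
  | .robot => IsIReopt w .robot c I T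

end Planning

/-! ### Random instances -/

/-- An order as a tuple `(K, S¹, …, S^K)`; this type carries the sum of the product σ-algebras. -/
abbrev OrderTuple := Σ k : ℕ, Fin k → Pt

/-- The set of picking locations of an order. -/
def locSet (o : OrderTuple) : Finset Pt := Finset.univ.image o.2

/-- At least one picking location, and all of them in aisles. -/
def IsOrder (w : Warehouse) (o : OrderTuple) : Prop := 1 ≤ o.1 ∧ ∀ i, w.OnAisle (o.2 i)

/-- The values `y 0, …, y (n-1)` in nondecreasing order. -/
def orderStat (n : ℕ) (y : ℕ → ℝ) : Fin n → ℝ :=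
  (fun i : Fin n => y i) ∘ Tuple.sort (fun i : Fin n => y i)

/-- The instance with the first `n` orders, the `j`-th of which arrives at the `j`-th order statistic
of the first `n` times. -/
def mkInstance (n : ℕ) (o : ℕ → OrderTuple) (y : ℕ → ℝ) : Instance n where
  locs j := locSet (o j)
  arr := orderStat n y

end OrderPicking

end

/-!
Any set of items of the warehouse can be collected in a bounded time `C`. Once the last order has
arrived, at time `R`, what remains to be done is part of the offline plan, up to a detour of length
`O(C)`; hence reoptimization completes by `R + CIOPT + O(C)`. It never completes before `CIOPT`,
because the walk that it executes is a feasible plan.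

By the strong law of large numbers, the average of the arrival times converges, so `R = o(n)`. Each
order forces the picker to walk at least the diameter of its set of locations (together with the
depot, for a pushcart). A batch serves at most `c` orders, so `c * CIOPT` is at least the sum of
these i.i.d. lower bounds, which by the strong law grows linearly as soon as their mean is positive.
If their mean is zero, everything lies at the depot and both completion times equal `R`.
-/

namespace OrderPicking

namespace Warehouse

variable {w : Warehouse} {p q s : Pt} {ℓ m t : ℝ}

/-- The aisles and the cross-aisles as subsets of the plane, collected in one finite family. -/
def line (w : Warehouse) : Fin w.a ⊕ Fin w.b → Set Pt
  | .inl i => {(i : ℝ) * (w.len / (w.a - 1))} ×ˢ Set.Icc 0 w.wid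
  | .inr k => Set.Icc 0 w.len ×ˢ {(k : ℝ) * (w.wid / (w.b - 1))}

theorem onAisle_iff : w.OnAisle p ↔ ∃ i, p ∈ w.line (.inl i) :=
  ⟨fun ⟨⟨i, hi, h⟩, h'⟩ => ⟨⟨i, hi⟩, h, h'⟩, fun ⟨i, h, h'⟩ => ⟨⟨i, i.2, h⟩, h'⟩⟩

theorem onCross_iff : w.OnCross p ↔ ∃ k, p ∈ w.line (.inr k) :=
  ⟨fun ⟨⟨k, hk, h⟩, h'⟩ => ⟨⟨k, hk⟩, h', h⟩, fun ⟨k, h', h⟩ => ⟨⟨k, k.2, h⟩, h'⟩⟩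

theorem walkable_iff : w.Walkable p ↔ ∃ i, p ∈ w.line i := by
  rw [Walkable, onAisle_iff, onCross_iff, Sum.exists]

theorem straight_iff : w.Straight p q ↔ ∃ i, p ∈ w.line i ∧ q ∈ w.line i := by
  rw [Sum.exists]
  refine or_congr ⟨?_, ?_⟩ ⟨?_, ?_⟩
  · rintro ⟨⟨⟨i, hi, hp⟩, hp'⟩, ⟨-, hq'⟩, h⟩
    exact ⟨⟨i, hi⟩, ⟨hp, hp'⟩, ⟨h.symm.trans hp, hq'⟩⟩
  · rintro ⟨i, hp, hq⟩
    exact ⟨onAisle_iff.2 ⟨i, hp⟩, onAisle_iff.2 ⟨i, hq⟩, hp.1.trans hq.1.symm⟩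
  · rintro ⟨⟨⟨i, hi, hp⟩, hp'⟩, ⟨-, hq'⟩, h⟩
    exact ⟨⟨i, hi⟩, ⟨hp', hp⟩, ⟨hq', h.symm.trans hp⟩⟩
  · rintro ⟨i, hp, hq⟩
    exact ⟨onCross_iff.2 ⟨i, hp⟩, onCross_iff.2 ⟨i, hq⟩, hp.2.trans hq.2.symm⟩

theorem convex_line (i) : Convex ℝ (w.line i) := by
  rcases i with i | k
  · exact (convex_singleton _).prod (convex_Icc _ _)
  · exact (convex_Icc _ _).prod (convex_singleton _)

theorem isCompact_line (i) : IsCompact (w.line i) := by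
  rcases i with i | k
  · exact isCompact_singleton.prod isCompact_Icc
  · exact isCompact_Icc.prod isCompact_singleton

theorem mul_div_sub_one_mem_Icc {L : ℝ} (hL : 0 ≤ L) {i k : ℕ} (hik : i < k) :
    (i : ℝ) * (L / (k - 1)) ∈ Set.Icc 0 L := by
  have hi : (i : ℝ) ≤ k - 1 := by
    rw [le_sub_iff_add_le]
    exact_mod_cast hik
  have hk : (0 : ℝ) ≤ k - 1 := i.cast_nonneg.trans hi
  refine ⟨by positivity, ?_⟩
  rw [mul_div_left_comm]
  exact mul_le_of_le_one_right hL (div_le_one_of_le₀ hi hk)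

theorem line_subset (i) : w.line i ⊆ Set.Icc 0 w.len ×ˢ Set.Icc 0 w.wid := by
  rcases i with i | k
  · exact Set.prod_mono_left
      (Set.singleton_subset_iff.2 (mul_div_sub_one_mem_Icc w.len_nonneg i.2))
  · exact Set.prod_mono_right
      (Set.singleton_subset_iff.2 (mul_div_sub_one_mem_Icc w.wid_nonneg k.2))

theorem Walkable.mem_Icc (hp : w.Walkable p) : p ∈ Set.Icc 0 w.len ×ˢ Set.Icc 0 w.wid :=
  let ⟨i, hi⟩ := walkable_iff.1 hp
  line_subset i hi

theorem walkable_depot : w.Walkable w.depot := w.depot_mem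

theorem Straight.symm (h : w.Straight p q) : w.Straight q p := by
  obtain ⟨i, hp, hq⟩ := straight_iff.1 h
  exact straight_iff.2 ⟨i, hq, hp⟩

theorem Straight.walkable_left (h : w.Straight p q) : w.Walkable p := by
  obtain ⟨i, hp, -⟩ := straight_iff.1 h
  exact walkable_iff.2 ⟨i, hp⟩

theorem Straight.walkable_right (h : w.Straight p q) : w.Walkable q :=
  h.symm.walkable_left

theorem Straight.route (h : w.Straight p q) : w.Route p q (|p.1 - q.1| + |p.2 - q.2|) := by
  simpa using Route.cons p q q 0 h (Route.refl q h.walkable_right)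

theorem Route.trans (h : w.Route p q ℓ) (h' : w.Route q s m) : w.Route p s (ℓ + m) := by
  induction h with
  | refl => simpa using h'
  | cons p q r ℓ hpq _ ih => simpa [add_assoc] using Route.cons p q s _ hpq (ih h')

theorem Route.symm (h : w.Route p q ℓ) : w.Route q p ℓ := by
  induction h with
  | refl p hp => exact Route.refl p hp
  | cons p q r ℓ hpq _ ih =>
    simpa [abs_sub_comm, add_comm] using ih.trans hpq.symm.route

theorem Route.walkable_left (h : w.Route p q ℓ) : w.Walkable p := by
  cases h with
  | refl _ hp => exact hp
  | cons _ _ _ _ hpq _ => exact hpq.walkable_left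

theorem Route.l1_le (h : w.Route p q ℓ) : |p.1 - q.1| + |p.2 - q.2| ≤ ℓ := by
  induction h with
  | refl => simp
  | cons p q r => linarith [abs_sub_le p.1 q.1 r.1, abs_sub_le p.2 q.2 r.2]

theorem Route.nonneg (h : w.Route p q ℓ) : 0 ≤ ℓ :=
  le_trans (by positivity) h.l1_le

theorem Straight.divide (h : w.Straight p q) (h0 : 0 ≤ t)
    (ht : t ≤ |p.1 - q.1| + |p.2 - q.2|) :
    ∃ m, w.Route p m t ∧ w.Route m q (|p.1 - q.1| + |p.2 - q.2| - t) := by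
  obtain ⟨i, hp, hq⟩ := straight_iff.1 h
  set e := |p.1 - q.1| + |p.2 - q.2| with he
  have hre : t / e * e = t := by
    rcases eq_or_ne e 0 with h | h
    · rw [h] at ht ⊢
      linarith
    · exact div_mul_cancel₀ t h
  have hr0 : 0 ≤ t / e := div_nonneg h0 (h0.trans ht)
  have hr1 : 0 ≤ 1 - t / e := sub_nonneg.2 (div_le_one_of_le₀ ht (h0.trans ht))
  set r := t / e
  have hm : p + r • (q - p) ∈ w.line i :=
    (convex_line i).add_smul_sub_mem hp hq ⟨hr0, sub_nonneg.1 hr1⟩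
  have hleft (x y : ℝ) : |x - (x + r * (y - x))| = r * |x - y| := by
    rw [show x - (x + r * (y - x)) = r * (x - y) by ring, abs_mul, abs_of_nonneg hr0]
  have hright (x y : ℝ) : |x + r * (y - x) - y| = (1 - r) * |x - y| := by
    rw [show x + r * (y - x) - y = (1 - r) * (x - y) by ring, abs_mul, abs_of_nonneg hr1]
  refine ⟨p + r • (q - p), ?_, ?_⟩
  · convert (straight_iff.2 ⟨i, hp, hm⟩).route using 1
    simp only [Prod.fst_add, Prod.snd_add, Prod.smul_fst, Prod.smul_snd, Prod.fst_sub,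
      Prod.snd_sub, smul_eq_mul, hleft]
    linear_combination -hre
  · convert (straight_iff.2 ⟨i, hm, hq⟩).route using 1
    simp only [Prod.fst_add, Prod.snd_add, Prod.smul_fst, Prod.smul_snd, Prod.fst_sub,
      Prod.snd_sub, smul_eq_mul, hright]
    linear_combination hre

theorem Route.divide (h : w.Route p q ℓ) (h0 : 0 ≤ t) (ht : t ≤ ℓ) :
    ∃ m, w.Route p m t ∧ w.Route m q (ℓ - t) := by
  induction h generalizing t with
  | refl p hp =>
    obtain rfl : t = 0 := le_antisymm ht h0
    exact ⟨p, Route.refl p hp, by simpa using Route.refl p hp⟩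
  | cons p q s ℓ hpq hqs ih =>
    set e := |p.1 - q.1| + |p.2 - q.2|
    rcases le_total t e with hte | hte
    · obtain ⟨m, h₁, h₂⟩ := hpq.divide h0 hte
      exact ⟨m, h₁, by simpa [e, sub_add_eq_add_sub] using h₂.trans hqs⟩
    · obtain ⟨m, h₁, h₂⟩ := ih (t := t - e) (sub_nonneg.2 hte) (by linarith)
      refine ⟨m, by simpa [e] using Route.cons p q m _ hpq h₁, ?_⟩
      rwa [add_comm e ℓ, add_sub_assoc, ← neg_sub t e, ← sub_eq_add_neg]

theorem Walkable.route_zero (hp : w.Walkable p) : w.Route p (0, 0) (p.1 + p.2) := by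
  obtain ⟨⟨hx, hx'⟩, hy, hy'⟩ := hp.mem_Icc
  have hcross : w.OnCross (p.1, 0) := ⟨⟨0, by have := w.two_le_b; omega, by simp⟩, hx, hx'⟩
  have hcross0 : w.OnCross (0, 0) := ⟨hcross.1, le_rfl, w.len_nonneg⟩
  have haisle : w.OnAisle (0, p.2) := ⟨⟨0, w.one_le_a, by simp⟩, hy, hy'⟩
  have haisle0 : w.OnAisle (0, 0) := ⟨haisle.1, le_rfl, w.wid_nonneg⟩
  rcases hp with hp | hp
  · have h₁ : w.Straight p (p.1, 0) := .inl ⟨hp, ⟨hp.1, le_rfl, w.wid_nonneg⟩, rfl⟩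
    have h₂ : w.Straight (p.1, 0) (0, 0) := .inr ⟨hcross, hcross0, rfl⟩
    simpa [abs_of_nonneg, hx, hy, add_comm] using h₁.route.trans h₂.route
  · have h₁ : w.Straight p (0, p.2) := .inr ⟨hp, ⟨hp.1, le_rfl, w.len_nonneg⟩, rfl⟩
    have h₂ : w.Straight (0, p.2) (0, 0) := .inl ⟨haisle, haisle0, rfl⟩
    simpa [abs_of_nonneg, hx, hy] using h₁.route.trans h₂.route

theorem exists_route (hp : w.Walkable p) (hq : w.Walkable q) : ∃ ℓ, w.Route p q ℓ :=
  ⟨_, hp.route_zero.trans hq.route_zero.symm⟩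

theorem Route.d_le (h : w.Route p q ℓ) : w.d p q ≤ ℓ :=
  csInf_le ⟨0, fun _ h => h.nonneg⟩ h

theorem Straight.d_le (h : w.Straight p q) : w.d p q ≤ |p.1 - q.1| + |p.2 - q.2| := h.route.d_le

variable (w) in
theorem d_nonneg (p q : Pt) : 0 ≤ w.d p q := Real.sInf_nonneg fun _ h => Route.nonneg h

variable (w) in
theorem d_comm (p q : Pt) : w.d p q = w.d q p :=
  congrArg sInf (Set.ext fun _ => ⟨Route.symm, Route.symm⟩)

variable (w) in
@[simp]
theorem d_self (p : Pt) : w.d p p = 0 := by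
  by_cases hp : w.Walkable p
  · exact le_antisymm (Route.refl p hp).d_le (w.d_nonneg p p)
  · have : {ℓ | w.Route p p ℓ} = ∅ :=
      Set.eq_empty_of_forall_notMem fun ℓ h => hp (Route.walkable_left h)
    rw [d, this, Real.sInf_empty]

theorem d_le_two_mul_len_add_wid (hp : w.Walkable p) (hq : w.Walkable q) :
    w.d p q ≤ 2 * (w.len + w.wid) := by
  obtain ⟨⟨-, hp₁⟩, -, hp₂⟩ := hp.mem_Icc
  obtain ⟨⟨-, hq₁⟩, -, hq₂⟩ := hq.mem_Icc
  linarith [(hp.route_zero.trans hq.route_zero.symm).d_le]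

theorem dist_le_d (hp : w.Walkable p) (hq : w.Walkable q) : dist p q ≤ w.d p q := by
  refine le_csInf (exists_route hp hq) fun ℓ h => le_trans ?_ (Route.l1_le h)
  rw [Prod.dist_eq, Real.dist_eq, Real.dist_eq]
  exact max_le_add_of_nonneg (abs_nonneg _) (abs_nonneg _)

theorem exists_route_lt (hp : w.Walkable p) (hq : w.Walkable q) {ε : ℝ} (hε : 0 < ε) :
    ∃ ℓ, w.Route p q ℓ ∧ ℓ < w.d p q + ε :=
  exists_lt_of_csInf_lt (exists_route hp hq) (lt_add_of_pos_right _ hε)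

theorem d_triangle (hp : w.Walkable p) (hq : w.Walkable q) (hs : w.Walkable s) :
    w.d p s ≤ w.d p q + w.d q s := by
  refine le_of_forall_pos_le_add fun ε hε => ?_
  obtain ⟨ℓ, h, hl⟩ := exists_route_lt hp hq (half_pos hε)
  obtain ⟨m, h', hm⟩ := exists_route_lt hq hs (half_pos hε)
  linarith [(h.trans h').d_le]

theorem setOf_walkable_eq_iUnion : {p | w.Walkable p} = ⋃ i, w.line i :=
  Set.ext fun p => by simp only [Set.mem_ofPred_eq, walkable_iff, Set.mem_iUnion]

theorem isCompact_setOf_walkable : IsCompact {p | w.Walkable p} := by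
  rw [setOf_walkable_eq_iUnion]
  exact isCompact_iUnion isCompact_line

theorem continuousOn_d (hp : w.Walkable p) : ContinuousOn (w.d p) {q | w.Walkable q} := by
  rw [setOf_walkable_eq_iUnion]
  refine (locallyFinite_of_finite _).continuousOn_iUnion (fun i => (isCompact_line i).isClosed)
    fun i => (LipschitzOnWith.of_le_add_mul 2 fun q hq s hs => ?_).continuousOn
  have hle : |s.1 - q.1| + |s.2 - q.2| ≤ 2 * dist q s := by
    rw [Prod.dist_eq, Real.dist_eq, Real.dist_eq, abs_sub_comm s.1, abs_sub_comm s.2, two_mul]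
    exact add_le_add (le_max_left _ _) (le_max_right _ _)
  have hd := (straight_iff.2 ⟨i, hs, hq⟩).d_le
  exact (d_triangle hp (walkable_iff.2 ⟨i, hs⟩) (walkable_iff.2 ⟨i, hq⟩)).trans
    (by gcongr; exact hd.trans hle)

theorem exists_between (hp : w.Walkable p) (hq : w.Walkable q) (h0 : 0 ≤ t) (ht : t ≤ w.d p q) :
    ∃ m, w.Walkable m ∧ w.d p m = t ∧ w.d p m + w.d m q = w.d p q := by
  have hcont : ContinuousOn (fun m => max (w.d p m - t) (w.d q m - (w.d p q - t)))
      {m | w.Walkable m} :=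
    ((continuousOn_d hp).sub continuousOn_const).sup ((continuousOn_d hq).sub continuousOn_const)
  obtain ⟨m, hm, hmin⟩ := isCompact_setOf_walkable.exists_isMinOn ⟨p, hp⟩ hcont
  have hle : max (w.d p m - t) (w.d q m - (w.d p q - t)) ≤ 0 := by
    refine le_of_forall_pos_le_add fun ε hε => ?_
    obtain ⟨ℓ, h, hl⟩ := exists_route_lt hp hq hε
    obtain ⟨m', h₁, h₂⟩ := h.divide h0 (ht.trans h.d_le)
    refine (hmin h₂.walkable_left).trans (max_le ?_ ?_)
    · linarith [h₁.d_le]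
    · linarith [h₂.symm.d_le]
  have h₁ := (le_max_left _ _).trans hle
  have h₂ := (le_max_right _ _).trans hle
  have h₃ := d_triangle hp hm hq
  rw [w.d_comm q m] at h₂
  exact ⟨m, hm, by linarith, by linarith⟩

theorem Walkable.add_mem_Icc (hp : w.Walkable p) : p.1 + p.2 ∈ Set.Icc 0 (w.len + w.wid) := by
  obtain ⟨⟨h₁, h₂⟩, h₃, h₄⟩ := hp.mem_Icc
  exact ⟨add_nonneg h₁ h₃, add_le_add h₂ h₄⟩

theorem d_le_abs_add_sub_add {i} (hp : p ∈ w.line i) (hq : q ∈ w.line i) :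
    w.d p q ≤ |q.1 + q.2 - (p.1 + p.2)| := by
  refine (straight_iff.2 ⟨i, hp, hq⟩).d_le.trans_eq ?_
  rw [abs_sub_comm p.1, abs_sub_comm p.2]
  rcases i with i | k
  · rw [show q.1 = p.1 from hq.1.trans hp.1.symm]
    simp
  · rw [show q.2 = p.2 from hq.2.trans hp.2.symm]
    simp

theorem two_mul_le_abs_sub_of_ne {D x y : ℝ} {i k : ℕ} (hik : i ≠ k) (hx : x ∈ Set.Icc 0 D)
    (hy : y ∈ Set.Icc 0 D) : 2 * D ≤ |k * (3 * D) + y - (i * (3 * D) + x)| := by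
  wlog hlt : i < k generalizing i k x y
  · rw [abs_sub_comm]
    exact this hik.symm hy hx (by omega)
  have hD : 0 ≤ D := hx.1.trans hx.2
  have hstep : ((i : ℝ) + 1) * (3 * D) ≤ k * (3 * D) := by
    gcongr
    exact_mod_cast hlt
  refine le_trans ?_ (le_abs_self _)
  linarith [hx.2, hy.1]

variable (w) in
theorem exists_d_le_abs_sub : ∃ (φ : Pt → ℝ) (M : ℝ), (∀ p, w.Walkable p → φ p ∈ Set.Icc 0 M) ∧
    ∀ p q, w.Walkable p → w.Walkable q → w.d p q ≤ |φ q - φ p| := by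
  have : Nonempty (Fin w.a ⊕ Fin w.b) := ⟨.inl ⟨0, w.one_le_a⟩⟩
  choose! i hi using fun p (hp : w.Walkable p) => walkable_iff.1 hp
  let N := Fintype.equivFin (Fin w.a ⊕ Fin w.b)
  have hD : 0 ≤ w.len + w.wid := add_nonneg w.len_nonneg w.wid_nonneg
  -- The lines are laid out one after the other on the real axis, with gaps that exceed `d`.
  refine ⟨fun p => (N (i p) : ℕ) * (3 * (w.len + w.wid)) + (p.1 + p.2),
    Fintype.card (Fin w.a ⊕ Fin w.b) * (3 * (w.len + w.wid)) + (w.len + w.wid),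
    fun p hp => ⟨?_, ?_⟩, fun p q hp hq => ?_⟩
  · exact add_nonneg (by positivity) hp.add_mem_Icc.1
  · refine add_le_add ?_ hp.add_mem_Icc.2
    gcongr
    exact (N (i p)).2.le
  rcases eq_or_ne (i p) (i q) with h | h
  · dsimp only
    rw [h, add_sub_add_left_eq_sub]
    exact d_le_abs_add_sub_add (h ▸ hi p hp) (hi q hq)
  · exact (d_le_two_mul_len_add_wid hp hq).trans <| two_mul_le_abs_sub_of_ne
      (fun hN => h (N.injective (Fin.val_injective hN))) hp.add_mem_Icc hq.add_mem_Icc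

end Warehouse

section Serving

variable {w : Warehouse} {sys : PickingSystem} {n : ℕ} {arr arr' : Fin n → ℝ} {X : Set Pt}
  {s s' : Pt × ℝ} {u : ℝ}

theorem batchEnd_mem (hX : w.depot ∈ X) {p : Pt} (hp : p ∈ X) : batchEnd w sys p ∈ X := by
  cases sys
  exacts [hX, hX, hp]

theorem batchEnd_batchEnd (p : Pt) :
    batchEnd w sys (batchEnd w sys p) = batchEnd w sys p := by
  cases sys <;> rfl

theorem Warehouse.Walkable.batchEnd {p : Pt} (hp : w.Walkable p) :
    w.Walkable (batchEnd w sys p) :=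
  batchEnd_mem (X := {p | w.Walkable p}) w.walkable_depot hp

theorem d_batchEnd_add_le {p q : Pt} (hp : w.Walkable p) (hq : w.Walkable q) :
    w.d p (batchEnd w sys p) + w.d (batchEnd w sys p) (batchEnd w sys q) ≤
      w.d p q + w.d q (batchEnd w sys q) := by
  cases sys
  · simpa [batchEnd] using Warehouse.d_triangle hp hq w.walkable_depot
  · simpa [batchEnd] using Warehouse.d_triangle hp hq w.walkable_depot
  · simp [batchEnd]

theorem serve_append (B B' : Tour n) (s : Pt × ℝ) :
    serve w arr (B ++ B') s = serve w arr B' (serve w arr B s) := by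
  induction B generalizing s with
  | nil => rfl
  | cons _ _ ih => exact ih _

theorem serve_fst_mem {B : Tour n} (hB : ∀ x ∈ B, x.2 ∈ X) (hs : s.1 ∈ X) :
    (serve w arr B s).1 ∈ X := by
  induction B generalizing s with
  | nil => exact hs
  | cons x _ ih =>
    rw [List.forall_mem_cons] at hB
    exact ih hB.2 hB.1

theorem le_serve (B : Tour n) (s : Pt × ℝ) : s.2 ≤ (serve w arr B s).2 := by
  induction B generalizing s with
  | nil => exact le_rfl
  | cons x B ih =>
    refine le_trans ?_ (ih _)
    exact le_max_of_le_left (le_add_of_nonneg_right (w.d_nonneg _ _))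

theorem serve_le_serveBatch (B : Tour n) (s : Pt × ℝ) :
    (serve w arr B s).2 ≤ (serveBatch w sys arr s B).2 :=
  le_add_of_nonneg_right (w.d_nonneg _ _)

theorem le_serveBatch (B : Tour n) (s : Pt × ℝ) : s.2 ≤ (serveBatch w sys arr s B).2 :=
  (le_serve B s).trans (serve_le_serveBatch B s)

theorem le_completion (P : List (Tour n)) (s : Pt × ℝ) : s.2 ≤ completion w sys arr s P := by
  induction P generalizing s with
  | nil => exact le_rfl
  | cons B P ih => exact (le_serveBatch B s).trans (ih _)

theorem arr_le_serve {B : Tour n} {x : Item n} (hx : x ∈ B) (s : Pt × ℝ) :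
    arr x.1 ≤ (serve w arr B s).2 := by
  induction B generalizing s with
  | nil => simp at hx
  | cons y B ih =>
    rcases List.mem_cons.1 hx with rfl | hx
    · exact (le_max_right (s.2 + w.d s.1 x.2) (arr x.1)).trans (le_serve B (x.2, _))
    · exact ih hx _

theorem arr_le_completion {P : List (Tour n)} {x : Item n} (hx : x ∈ P.flatten) (s : Pt × ℝ) :
    arr x.1 ≤ completion w sys arr s P := by
  induction P generalizing s with
  | nil => simp at hx
  | cons B P ih =>
    rw [List.flatten_cons, List.mem_append] at hx
    rcases hx with hx | hx
    · exact ((arr_le_serve hx s).trans (serve_le_serveBatch B s)).trans (le_completion P _)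
    · exact ih hx _

theorem serve_congr_of_arrived {B : Tour n} (h : ∀ x ∈ B, arr x.1 ≤ s.2)
    (h' : ∀ x ∈ B, arr' x.1 ≤ s.2) : serve w arr B s = serve w arr' B s := by
  induction B generalizing s with
  | nil => rfl
  | cons x B ih =>
    rw [List.forall_mem_cons] at h h'
    have hle : s.2 ≤ s.2 + w.d s.1 x.2 := le_add_of_nonneg_right (w.d_nonneg _ _)
    simp only [serve, max_eq_left (h.1.trans hle), max_eq_left (h'.1.trans hle)]
    exact ih (fun y hy => (h.2 y hy).trans hle) fun y hy => (h'.2 y hy).trans hle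

theorem serve_zero_add (B : Tour n) (p : Pt) {t : ℝ} (ht : 0 ≤ t) (hu : 0 ≤ u) :
    serve w (fun _ : Fin n => 0) B (p, t + u) =
      ((serve w (fun _ => 0) B (p, t)).1, (serve w (fun _ => 0) B (p, t)).2 + u) := by
  induction B generalizing p t with
  | nil => rfl
  | cons x B ih =>
    have htd : 0 ≤ t + w.d p x.2 := add_nonneg ht (w.d_nonneg _ _)
    simp only [serve]
    rw [add_right_comm, max_eq_left htd, max_eq_left (add_nonneg htd hu), ih _ htd]

theorem completion_zero_add (P : List (Tour n)) (p : Pt) {t : ℝ} (ht : 0 ≤ t) (hu : 0 ≤ u) :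
    completion w sys (fun _ => 0) (p, t + u) P = completion w sys (fun _ => 0) (p, t) P + u := by
  induction P generalizing p t with
  | nil => rfl
  | cons B P ih =>
    have h : serveBatch w sys (fun _ => 0) (p, t + u) B =
        ((serveBatch w sys (fun _ => 0) (p, t) B).1,
          (serveBatch w sys (fun _ => 0) (p, t) B).2 + u) := by
      simp only [serveBatch, serve_zero_add B p ht hu, add_right_comm]
    exact (congrArg (completion w sys _ · P) h).trans (ih _ (ht.trans (le_serveBatch B (p, t))))

theorem completion_zero_eq_add (P : List (Tour n)) (p : Pt) (hu : 0 ≤ u) :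
    completion w sys (fun _ => 0) (p, u) P = completion w sys (fun _ => 0) (p, 0) P + u := by
  rw [← completion_zero_add P p le_rfl hu, zero_add]

end Serving

section Dominates

variable {w : Warehouse} {sys : PickingSystem} {n : ℕ} {arr arr' : Fin n → ℝ} {s s' : Pt × ℝ}
  {u : ℝ}

/-- A picker at the place and time `s` can be at the place of `s'` with a delay of at most `u`.
This relation between two walks is preserved when both serve the same tours, or when the first one
skips some of the items (`Dominates.foldl_restrict`). -/
structure Dominates (w : Warehouse) (u : ℝ) (s s' : Pt × ℝ) : Prop where
  left : w.Walkable s.1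
  right : w.Walkable s'.1
  le : s.2 + w.d s.1 s'.1 ≤ s'.2 + u

theorem Dominates.refl (hs : w.Walkable s.1) : Dominates w 0 s s :=
  ⟨hs, hs, by simp⟩

theorem Dominates.time_le (h : Dominates w u s s') : s.2 ≤ s'.2 + u :=
  (le_add_of_nonneg_right (w.d_nonneg _ _)).trans h.le

theorem Dominates.trans_walk {q : Pt} {t : ℝ} (h : Dominates w u s s') (hq : w.Walkable q)
    (ht : s'.2 + w.d s'.1 q ≤ t) : Dominates w u s (q, t) :=
  ⟨h.left, hq, by linarith [Warehouse.d_triangle h.left h.right hq, h.le]⟩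

theorem Dominates.serve_filter (harr : ∀ k, arr k ≤ arr' k + u) (f : Item n → Bool) {B : Tour n}
    (hB : ∀ x ∈ B, w.Walkable x.2) (h : Dominates w u s s') :
    Dominates w u (serve w arr (B.filter f) s) (serve w arr' B s') := by
  induction B generalizing s s' with
  | nil => exact h
  | cons x B ih =>
    rw [List.forall_mem_cons] at hB
    have hx := h.trans_walk hB.1 (le_max_left _ (arr' x.1))
    rw [List.filter_cons]
    split_ifs
    · refine ih hB.2 ⟨hB.1, hB.1, ?_⟩
      rw [Warehouse.d_self, add_zero]
      exact max_le hx.le ((harr x.1).trans (by gcongr; exact le_max_right _ _))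
    · exact ih hB.2 hx

theorem Dominates.serve (harr : ∀ k, arr k ≤ arr' k + u) {B : Tour n}
    (hB : ∀ x ∈ B, w.Walkable x.2) (h : Dominates w u s s') :
    Dominates w u (serve w arr B s) (serve w arr' B s') := by
  simpa using h.serve_filter harr (fun _ => true) hB

theorem Dominates.batchEnd (h : Dominates w u s s') :
    Dominates w u (batchEnd w sys s.1, s.2 + w.d s.1 (batchEnd w sys s.1))
      (batchEnd w sys s'.1, s'.2 + w.d s'.1 (OrderPicking.batchEnd w sys s'.1)) := by
  refine ⟨h.left.batchEnd, h.right.batchEnd, ?_⟩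
  linarith [d_batchEnd_add_le (sys := sys) h.left h.right, h.le]

theorem Dominates.serveBatch (harr : ∀ k, arr k ≤ arr' k + u) {B : Tour n}
    (hB : ∀ x ∈ B, w.Walkable x.2) (h : Dominates w u s s') :
    Dominates w u (serveBatch w sys arr s B) (serveBatch w sys arr' s' B) :=
  (h.serve harr hB).batchEnd

/-- The batches that remain when only the items with `f` are collected. -/
def restrict {n : ℕ} (f : Item n → Bool) (P : List (Tour n)) : List (Tour n) :=
  (P.map (List.filter f)).filter fun B => !B.isEmpty

theorem restrict_cons (f : Item n → Bool) (B : Tour n) (P : List (Tour n)) :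
    restrict f (B :: P) =
      if B.filter f = [] then restrict f P else B.filter f :: restrict f P := by
  simp only [restrict, List.map_cons, List.filter_cons, Bool.not_eq_true',
    List.isEmpty_eq_false_iff, ne_eq, ite_not]

theorem flatten_restrict (f : Item n → Bool) (P : List (Tour n)) :
    (restrict f P).flatten = P.flatten.filter f := by
  rw [restrict, List.flatten_filter_not_isEmpty, List.filter_flatten]

theorem Dominates.foldl_restrict (harr : ∀ k, arr k ≤ arr' k + u) (f : Item n → Bool)
    {P : List (Tour n)} (hP : ∀ B ∈ P, ∀ x ∈ B, w.Walkable x.2) (h : Dominates w u s s') :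
    Dominates w u ((restrict f P).foldl (OrderPicking.serveBatch w sys arr) s)
      (P.foldl (OrderPicking.serveBatch w sys arr') s') := by
  induction P generalizing s s' with
  | nil => exact h
  | cons B P ih =>
    rw [List.forall_mem_cons] at hP
    have hB := h.serve_filter harr f hP.1
    rw [restrict_cons]
    split_ifs with he
    · rw [he] at hB
      exact ih hP.2 (hB.trans_walk hB.right.batchEnd le_rfl)
    · exact ih hP.2 hB.batchEnd

theorem completion_restrict_le (harr : ∀ k, arr k ≤ arr' k + u) (f : Item n → Bool)
    {P : List (Tour n)} (hP : ∀ B ∈ P, ∀ x ∈ B, w.Walkable x.2) (h : Dominates w u s s') :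
    completion w sys arr s (restrict f P) ≤ completion w sys arr' s' P + u :=
  (h.foldl_restrict harr f hP).time_le

end Dominates

section TourRegion

variable {w : Warehouse} {n : ℕ} {X : Set Pt} {C : ℝ}

/-- A part `X` of the warehouse that a picker with destinations in `X` never leaves, and in which
every set of items, whatever its size, can be collected within time `C`. The two regions of interest
are the whole warehouse and the depot alone. -/
structure IsTourRegion (w : Warehouse) (X : Set Pt) (C : ℝ) : Prop where
  walkable : ∀ p ∈ X, w.Walkable p
  depot_mem : w.depot ∈ X
  mem_of_between : ∀ p ∈ X, ∀ q ∈ X, ∀ m, w.Walkable m → w.d p m + w.d m q = w.d p q → m ∈ X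
  d_le : ∀ p ∈ X, ∀ q ∈ X, w.d p q ≤ C
  exists_perm_serve_le : ∀ {n : ℕ} (B : Tour n), (∀ x ∈ B, x.2 ∈ X) →
    ∃ B', B'.Perm B ∧ ∀ p ∈ X, (serve w (fun _ => 0) B' (p, 0)).2 ≤ C

theorem IsTourRegion.nonneg (h : IsTourRegion w X C) : 0 ≤ C :=
  (w.d_nonneg _ _).trans (h.d_le _ h.depot_mem _ h.depot_mem)

theorem serve_le_of_sorted {φ : Pt → ℝ} {M : ℝ} (hM : ∀ p, w.Walkable p → φ p ≤ M)
    (hφ : ∀ p q, w.Walkable p → w.Walkable q → w.d p q ≤ |φ q - φ p|) {B : Tour n}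
    (hB : ∀ x ∈ B, w.Walkable x.2) (hsort : B.Pairwise fun x y => φ x.2 ≤ φ y.2) {p : Pt}
    (hp : w.Walkable p) (hpB : ∀ x ∈ B, φ p ≤ φ x.2) {t : ℝ} (ht : 0 ≤ t) :
    (serve w (fun _ => 0) B (p, t)).2 ≤ t + (M - φ p) := by
  induction B generalizing p t with
  | nil => exact le_add_of_nonneg_right (sub_nonneg.2 (hM p hp))
  | cons x B ih =>
    rw [List.forall_mem_cons] at hB hpB
    have hd := hφ p x.2 hp hB.1
    rw [abs_of_nonneg (sub_nonneg.2 hpB.1)] at hd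
    have htd : 0 ≤ t + w.d p x.2 := add_nonneg ht (w.d_nonneg _ _)
    simp only [serve, max_eq_left htd]
    linarith [ih hB.2 hsort.of_cons hB.1 (fun _ => List.rel_of_pairwise_cons hsort) htd]

theorem exists_isTourRegion_walkable (w : Warehouse) :
    ∃ C, IsTourRegion w {p | w.Walkable p} C := by
  obtain ⟨φ, M, hM, hφ⟩ := w.exists_d_le_abs_sub
  have hd : ∀ p, w.Walkable p → ∀ q, w.Walkable q → w.d p q ≤ M := fun p hp q hq =>
    (hφ p q hp hq).trans <|
      abs_sub_le_of_nonneg_of_le (hM q hq).1 (hM q hq).2 (hM p hp).1 (hM p hp).2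
  have hM0 : 0 ≤ M := (w.d_nonneg _ _).trans (hd _ w.walkable_depot _ w.walkable_depot)
  refine ⟨2 * M, fun _ hp => hp, w.walkable_depot, fun _ _ _ _ _ hm _ => hm,
    fun p hp q hq => (hd p hp q hq).trans (by linarith), fun {n} B hB => ?_⟩
  let r : Item n → Item n → Prop := fun x y => φ x.2 ≤ φ y.2
  have : DecidableRel r := Classical.decRel r
  have : Std.Total r := ⟨fun x y => le_total _ _⟩
  have : IsTrans (Item n) r := ⟨fun x y z => le_trans⟩
  have hperm := List.perm_insertionSort r B
  have hsort : (B.insertionSort r).Pairwise r := List.pairwise_insertionSort r B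
  refine ⟨B.insertionSort r, hperm, fun p hp => ?_⟩
  have hB' : ∀ x ∈ B.insertionSort r, w.Walkable x.2 := fun x hx => hB x (hperm.mem_iff.1 hx)
  generalize B.insertionSort r = B' at hsort hB'
  cases B' with
  | nil => exact mul_nonneg two_pos.le hM0
  | cons x B' =>
    rw [List.forall_mem_cons] at hB'
    have hd0 := w.d_nonneg p x.2
    have hserve := serve_le_of_sorted (fun p hp => (hM p hp).2) hφ hB'.2 hsort.of_cons hB'.1
      (fun _ => List.rel_of_pairwise_cons hsort) hd0
    simp only [serve, zero_add, max_eq_left hd0]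
    linarith [hd p hp x.2 hB'.1, (hM x.2 hB'.1).1]

theorem serve_of_forall_eq {B : Tour n} {p : Pt} (hB : ∀ x ∈ B, x.2 = p) {t : ℝ} (ht : 0 ≤ t) :
    serve w (fun _ => 0) B (p, t) = (p, t) := by
  induction B with
  | nil => rfl
  | cons x B ih =>
    rw [List.forall_mem_cons] at hB
    simp only [serve, hB.1, Warehouse.d_self, add_zero, max_eq_left ht]
    exact ih hB.2

theorem isTourRegion_depot (w : Warehouse) : IsTourRegion w {w.depot} 0 where
  walkable := by rintro _ rfl; exact w.walkable_depot
  depot_mem := rfl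
  mem_of_between := by
    rintro _ rfl _ rfl m hm h
    rw [Warehouse.d_self] at h
    have hd := Warehouse.dist_le_d hm w.walkable_depot
    exact dist_le_zero.1 (hd.trans (by linarith [w.d_nonneg w.depot m]))
  d_le := by rintro _ rfl _ rfl; exact (w.d_self _).le
  exists_perm_serve_le B hB := by
    refine ⟨B, .refl B, ?_⟩
    rintro _ rfl
    rw [serve_of_forall_eq hB le_rfl]

end TourRegion

section Plans

variable {w : Warehouse} {sys : PickingSystem} {n c : ℕ} {Q Q' : Set (Item n)} {B B' : Tour n}
  {P P' : List (Tour n)} {I : Instance n}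

theorem mem_ordersOf {k : Fin n} : k ∈ ordersOf B ↔ ∃ x ∈ B, x.1 = k := by
  simp [ordersOf]

theorem ordersOf_mono (h : B ⊆ B') : ordersOf B ⊆ ordersOf B' := by
  intro k hk
  obtain ⟨x, hx, rfl⟩ := mem_ordersOf.1 hk
  exact mem_ordersOf.2 ⟨x, h hx, rfl⟩

theorem ordersOf_append (B B' : Tour n) : ordersOf (B ++ B') = ordersOf B ∪ ordersOf B' := by
  simp [ordersOf]

theorem ordersOf_eq_empty_iff : ordersOf B = ∅ ↔ B = [] := by
  simp [ordersOf]

/-- A solution for the items `Q` in which batches may be empty. -/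
structure IsPreplan {n : ℕ} (c : ℕ) (Q : Set (Item n)) (P : List (Tour n)) : Prop where
  nodup : P.flatten.Nodup
  cover : ∀ x, x ∈ P.flatten ↔ x ∈ Q
  capacity : ∀ B ∈ P, (ordersOf B).card ≤ c
  unsplit : P.Pairwise fun B B' => Disjoint (ordersOf B) (ordersOf B')

theorem IsPlan.isPreplan (h : IsPlan c Q P) : IsPreplan c Q P :=
  ⟨h.nodup, h.cover, h.capacity, h.unsplit⟩

theorem isPreplan_nil : IsPreplan c (∅ : Set (Item n)) [] :=
  ⟨List.nodup_nil, by simp, by simp, .nil⟩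

theorem isPreplan_singleton (hB : B.Nodup) (hc : (ordersOf B).card ≤ c) :
    IsPreplan c {x | x ∈ B} [B] :=
  ⟨by simpa using hB, by simp, by simpa using hc, List.pairwise_singleton _ _⟩

theorem IsPreplan.append (h : IsPreplan c Q P) (h' : IsPreplan c Q' P')
    (hne : ∀ x ∈ Q, ∀ y ∈ Q', x.1 ≠ y.1) : IsPreplan c (Q ∪ Q') (P ++ P') where
  nodup := by
    rw [List.flatten_append, List.nodup_append']
    exact ⟨h.nodup, h'.nodup, fun x hx hx' => hne x ((h.cover x).1 hx) x ((h'.cover x).1 hx') rfl⟩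
  cover x := by
    rw [List.flatten_append, List.mem_append, h.cover, h'.cover, Set.mem_union]
  capacity B hB := (List.mem_append.1 hB).elim (h.capacity B) (h'.capacity B)
  unsplit := by
    refine List.pairwise_append.2 ⟨h.unsplit, h'.unsplit, fun B hB B' hB' => ?_⟩
    refine Finset.disjoint_left.2 fun k hk hk' => ?_
    obtain ⟨x, hx, rfl⟩ := mem_ordersOf.1 hk
    obtain ⟨y, hy, hxy⟩ := mem_ordersOf.1 hk'
    exact hne x ((h.cover x).1 (List.mem_flatten_of_mem hB hx)) y
      ((h'.cover y).1 (List.mem_flatten_of_mem hB' hy)) hxy.symm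

theorem IsPreplan.left_of_append (h : IsPreplan c Q (P ++ P')) :
    IsPreplan c {x | x ∈ P.flatten} P where
  nodup := h.nodup.sublist (by simp)
  cover _ := .rfl
  capacity B hB := h.capacity B (List.mem_append_left _ hB)
  unsplit := (List.pairwise_append.1 h.unsplit).1

theorem IsPreplan.fst_ne_of_append (h : IsPreplan c Q (P ++ P')) {x y : Item n}
    (hx : x ∈ P.flatten) (hy : y ∈ P'.flatten) : x.1 ≠ y.1 := by
  obtain ⟨B, hB, hxB⟩ := List.mem_flatten.1 hx
  obtain ⟨B', hB', hyB'⟩ := List.mem_flatten.1 hy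
  intro hxy
  exact Finset.disjoint_left.1 ((List.pairwise_append.1 h.unsplit).2.2 B hB B' hB')
    (mem_ordersOf.2 ⟨x, hxB, rfl⟩) (mem_ordersOf.2 ⟨y, hyB', hxy.symm⟩)

theorem IsPreplan.restrict (h : IsPreplan c Q P) (f : Item n → Bool) :
    IsPlan c {x | x ∈ Q ∧ f x} (restrict f P) where
  nodup := by
    rw [flatten_restrict]
    exact h.nodup.filter f
  cover x := by
    rw [flatten_restrict, List.mem_filter, h.cover]
    rfl
  nonempty B hB := by
    simpa using (List.mem_filter.1 hB).2
  capacity B hB := by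
    obtain ⟨C, hC, rfl⟩ := List.mem_map.1 (List.mem_filter.1 hB).1
    exact (Finset.card_le_card (ordersOf_mono (List.filter_subset_self C))).trans (h.capacity C hC)
  unsplit := by
    refine List.Pairwise.filter _ (List.pairwise_map.2 (h.unsplit.imp fun hd => ?_))
    exact hd.mono (ordersOf_mono (List.filter_subset_self _))
      (ordersOf_mono (List.filter_subset_self _))

theorem IsPreplan.exists_isPlan_completion_le (h : IsPreplan c Q P)
    (hQ : ∀ x ∈ Q, w.Walkable x.2) (hQ' : Q' ⊆ Q) {arr arr' : Fin n → ℝ} {s s' : Pt × ℝ} {u : ℝ}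
    (harr : ∀ k, arr k ≤ arr' k + u) (hs : Dominates w u s s') :
    ∃ P', IsPlan c Q' P' ∧ completion w sys arr s P' ≤ completion w sys arr' s' P + u := by
  classical
  have hw : ∀ B ∈ P, ∀ x ∈ B, w.Walkable x.2 := fun B hB x hx =>
    hQ x ((h.cover x).1 (List.mem_flatten_of_mem hB hx))
  refine ⟨OrderPicking.restrict (fun x => decide (x ∈ Q')) P, ?_,
    completion_restrict_le harr _ hw hs⟩
  convert h.restrict fun x => decide (x ∈ Q') using 1
  ext x
  simpa using fun hx => hQ' hx

theorem IsPlan.of_perm (h : IsPlan c Q P) (hperm : P'.flatten.Perm P.flatten)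
    (hord : P'.map ordersOf = P.map ordersOf) : IsPlan c Q P' := by
  have hmem : ∀ B ∈ P', ∃ C ∈ P, ordersOf C = ordersOf B := fun B hB =>
    List.mem_map.1 (hord ▸ List.mem_map_of_mem hB)
  refine ⟨hperm.nodup_iff.2 h.nodup, fun x => hperm.mem_iff.trans (h.cover x), ?_, ?_, ?_⟩
  · intro B hB
    obtain ⟨C, hC, hCB⟩ := hmem B hB
    rw [ne_eq, ← ordersOf_eq_empty_iff, ← hCB, ordersOf_eq_empty_iff]
    exact h.nonempty C hC
  · intro B hB
    obtain ⟨C, hC, hCB⟩ := hmem B hB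
    exact hCB ▸ h.capacity C hC
  · have hu := h.unsplit
    rwa [← List.pairwise_map, ← hord, List.pairwise_map] at hu

theorem exists_isPlan (hc : 1 ≤ c) (hQ : Q.Finite) : ∃ P, IsPlan c Q P := by
  classical
  suffices h : ∀ A : Finset (Fin n), ∃ P, IsPreplan c {x | x ∈ Q ∧ x.1 ∈ A} P by
    obtain ⟨P, hP⟩ := h Finset.univ
    exact ⟨_, by simpa using hP.restrict fun _ => true⟩
  intro A
  induction A using Finset.induction_on with
  | empty => exact ⟨[], by simpa using isPreplan_nil⟩
  | insert k A hk ih =>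
    obtain ⟨P, hP⟩ := ih
    obtain ⟨B, hnd, hB⟩ : ∃ B : Tour n, B.Nodup ∧ ∀ x, x ∈ B ↔ x ∈ Q ∧ x.1 = k :=
      ⟨(hQ.toFinset.filter fun x => x.1 = k).toList, Finset.nodup_toList _, by simp⟩
    have hcard : (ordersOf B).card ≤ c := by
      refine (Finset.card_le_card (t := {k}) fun l hl => ?_).trans (by simpa using hc)
      obtain ⟨x, hx, rfl⟩ := mem_ordersOf.1 hl
      exact Finset.mem_singleton.2 ((hB x).1 hx).2
    refine ⟨[B] ++ P, ?_⟩
    convert (isPreplan_singleton hnd hcard).append hP ?_ using 1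
    · ext x
      simp only [Set.mem_ofPred_eq, Set.mem_union, Finset.mem_insert, hB]
      tauto
    · rintro x hx y ⟨-, hy⟩ hxy
      exact hk (((hB x).1 hx).2 ▸ hxy ▸ hy)

theorem finite_setOf_forall_mem_length_le {α : Type*} {S : Set α} (hS : S.Finite) (N : ℕ) :
    {l : List α | (∀ x ∈ l, x ∈ S) ∧ l.length ≤ N}.Finite := by
  have := hS.to_subtype
  refine ((List.finite_length_le S N).image (List.map Subtype.val)).subset ?_
  rintro l ⟨hl, hN⟩
  lift l to List S using hl
  exact ⟨l, by simpa using hN, rfl⟩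

theorem finite_setOf_nodup {α : Type*} {S : Set α} (hS : S.Finite) :
    {l : List α | l.Nodup ∧ ∀ x ∈ l, x ∈ S}.Finite := by
  classical
  refine (finite_setOf_forall_mem_length_le hS hS.toFinset.card).subset ?_
  rintro l ⟨hnd, hl⟩
  refine ⟨hl, ?_⟩
  rw [← List.toFinset_card_of_nodup hnd]
  exact Finset.card_le_card fun x hx => by simpa using hl x (by simpa using hx)

theorem length_le_length_flatten {α : Type*} {P : List (List α)} (h : ∀ B ∈ P, B ≠ []) :
    P.length ≤ P.flatten.length := by
  induction P with
  | nil => exact le_rfl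
  | cons B P ih =>
    rw [List.forall_mem_cons] at h
    have hB := List.length_pos_iff.2 h.1
    simp only [List.length_cons, List.flatten_cons, List.length_append]
    linarith [ih h.2]

theorem finite_setOf_nodup_flatten {α : Type*} {S : Set α} (hS : S.Finite) :
    {P : List (List α) |
      P.flatten.Nodup ∧ (∀ x ∈ P.flatten, x ∈ S) ∧ ∀ B ∈ P, B ≠ []}.Finite := by
  obtain ⟨N, hN⟩ := ((finite_setOf_nodup hS).image List.length).bddAbove
  refine (finite_setOf_forall_mem_length_le (finite_setOf_nodup hS) N).subset ?_
  rintro P ⟨hnd, hmem, hne⟩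
  exact ⟨fun B hB => ⟨(List.nodup_flatten.1 hnd).1 B hB,
      fun x hx => hmem x (List.mem_flatten_of_mem hB hx)⟩,
    (length_le_length_flatten hne).trans (hN ⟨_, ⟨hnd, hmem⟩, rfl⟩)⟩

theorem exists_isOptimalPlan (w : Warehouse) (sys : PickingSystem) (hc : 1 ≤ c) (hQ : Q.Finite) :
    ∃ P, IsOptimalPlan w sys c Q P :=
  Set.exists_min_image {P | IsPlan c Q P} (completion w sys (fun _ => 0) (w.depot, 0))
    ((finite_setOf_nodup_flatten hQ).subset fun _ hP =>
      ⟨hP.nodup, fun x => (hP.cover x).1, hP.nonempty⟩)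
    (exists_isPlan hc hQ)

theorem isReplan_of_isPlan {cart : Finset (Fin n)} {cur : Tour n} (hcart : cart.card ≤ c)
    (hnd : cur.Nodup) (hcur : ∀ x, x ∈ cur ↔ x ∈ Q ∧ x.1 ∈ cart)
    (hP : IsPlan c {x | x ∈ Q ∧ x.1 ∉ cart} P) : IsReplan c cart Q cur P := by
  have hord : ordersOf cur ⊆ cart := fun k hk => by
    obtain ⟨x, hx, rfl⟩ := mem_ordersOf.1 hk
    exact ((hcur x).1 hx).2
  have hne : ∀ x ∈ {x | x ∈ cur}, ∀ y ∈ {x | x ∈ Q ∧ x.1 ∉ cart}, x.1 ≠ y.1 :=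
    fun x hx y hy hxy => hy.2 (hxy ▸ ((hcur x).1 hx).2)
  have h := (isPreplan_singleton hnd ((Finset.card_le_card hord).trans hcart)).append
    hP.isPreplan hne
  refine ⟨h.nodup, fun x => (h.cover x).trans ?_, fun x hx hxc => (hcur x).2 ⟨hx, hxc⟩,
    hP.nonempty, by rwa [Finset.union_eq_left.2 hord], hP.capacity, h.unsplit⟩
  simp only [Set.mem_union, Set.mem_ofPred_eq, hcur]
  tauto

theorem exists_isOptimalReplan (w : Warehouse) (sys : PickingSystem) (hc : 1 ≤ c) (p : Pt)
    {cart : Finset (Fin n)} (hcart : cart.card ≤ c) (hQ : Q.Finite) :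
    ∃ cur fut, IsOptimalReplan w sys c p cart Q cur fut := by
  classical
  have hex : {R : Tour n × List (Tour n) | IsReplan c cart Q R.1 R.2}.Nonempty := by
    obtain ⟨P, hP⟩ := exists_isPlan (Q := {x | x ∈ Q ∧ x.1 ∉ cart}) hc (hQ.subset fun x hx => hx.1)
    exact ⟨((hQ.toFinset.filter fun x => x.1 ∈ cart).toList, P),
      isReplan_of_isPlan hcart (Finset.nodup_toList _) (by simp) hP⟩
  have hfin : {R : Tour n × List (Tour n) | IsReplan c cart Q R.1 R.2}.Finite := by
    refine ((finite_setOf_nodup hQ).prod (finite_setOf_nodup_flatten hQ)).subset fun R hR => ?_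
    have hnd := List.nodup_append'.1 hR.nodup
    exact ⟨⟨hnd.1, fun x hx => (hR.cover x).1 (List.mem_append_left _ hx)⟩, hnd.2.1,
      fun x hx => (hR.cover x).1 (List.mem_append_right _ hx), hR.nonempty⟩
  obtain ⟨⟨cur, fut⟩, hR, hmin⟩ := Set.exists_min_image _
    (fun R : Tour n × List (Tour n) => completion w sys (fun _ => 0) (p, 0) (R.1 :: R.2)) hfin hex
  exact ⟨cur, fut, hR, fun cur' fut' h => hmin (cur', fut') h⟩

end Plans

namespace Instance

variable {n : ℕ} {I : Instance n} {A A' : Finset (Fin n)} {X : Set Pt}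

/-- All picking locations of the instance lie in `X`. -/
def LocsIn (I : Instance n) (X : Set Pt) : Prop := ∀ k, ∀ p ∈ I.locs k, p ∈ X

theorem LocsIn.mono {X' : Set Pt} (hI : I.LocsIn X) (h : X ⊆ X') : I.LocsIn X' :=
  fun k p hp => h (hI k p hp)

theorem LocsIn.mem (hI : I.LocsIn X) {x : Item n} (hx : x ∈ I.itemsOf A) : x.2 ∈ X :=
  hI _ _ hx.2

theorem itemsOf_mono (h : A ⊆ A') : I.itemsOf A ⊆ I.itemsOf A' := fun _ hx => ⟨h hx.1, hx.2⟩

theorem finite_itemsOf (I : Instance n) (A : Finset (Fin n)) : (I.itemsOf A).Finite := by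
  refine (Finset.finite_toSet (A.sigma I.locs)).image (fun x => (x.1, x.2)) |>.subset ?_
  rintro ⟨k, p⟩ ⟨hk, hp⟩
  exact ⟨⟨k, p⟩, by simpa using ⟨hk, hp⟩, rfl⟩

theorem mem_arrived {t : ℝ} {k : Fin n} : k ∈ I.arrived t ↔ I.arr k ≤ t := by
  simp [arrived]

theorem exists_isNext (hA : ∃ k, k ∉ A) : ∃ k, I.IsNext A k := by
  obtain ⟨k, hk, hmin⟩ := Finset.exists_min_image Aᶜ I.arr (by simpa [Finset.Nonempty] using hA)
  exact ⟨k, Finset.mem_compl.1 hk, fun m hm => hmin m (Finset.mem_compl.2 hm)⟩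

theorem card_compl_arrived_lt {t : ℝ} (hA : ∀ k ∈ A, I.arr k ≤ t)
    (hnew : ∃ k, k ∉ A ∧ I.arr k ≤ t) : (I.arrived t)ᶜ.card < Aᶜ.card := by
  obtain ⟨k, hk, hkt⟩ := hnew
  refine Finset.card_lt_card (Finset.compl_ssubset_compl.2 ?_)
  exact Finset.ssubset_iff_of_subset (fun m hm => mem_arrived.2 (hA m hm)) |>.2
    ⟨k, mem_arrived.2 hkt, hk⟩

end Instance

section CompleteInformation

variable {w : Warehouse} {sys : PickingSystem} {n c : ℕ} {I : Instance n} {P : List (Tour n)}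

theorem ciopt_le (hI : I.LocsIn {p | w.Walkable p}) (hP : IsPreplan c (I.itemsOf Finset.univ) P) :
    CIOPT w sys c I ≤ completion w sys I.arr (w.depot, 0) P := by
  obtain ⟨P', hP', hle⟩ := hP.exists_isPlan_completion_le (sys := sys) (fun _ => hI.mem) subset_rfl
    (fun k => (add_zero (I.arr k)).ge) (Dominates.refl (s := (w.depot, 0)) w.walkable_depot)
  rw [add_zero] at hle
  refine le_trans (csInf_le ⟨0, ?_⟩ ⟨P', hP', rfl⟩) hle
  rintro _ ⟨P, -, rfl⟩
  exact le_completion P (w.depot, 0)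

theorem le_ciopt (hc : 1 ≤ c) {T : ℝ} (h : ∀ P, IsPlan c (I.itemsOf Finset.univ) P →
    T ≤ completion w sys I.arr (w.depot, 0) P) : T ≤ CIOPT w sys c I := by
  obtain ⟨P, hP⟩ := exists_isPlan hc (I.finite_itemsOf Finset.univ)
  refine le_csInf ⟨_, P, hP, rfl⟩ ?_
  rintro _ ⟨P, hP, rfl⟩
  exact h P hP

theorem arr_le_ciopt (hc : 1 ≤ c) {k : Fin n} (hk : (I.locs k).Nonempty) :
    I.arr k ≤ CIOPT w sys c I := by
  obtain ⟨p, hp⟩ := hk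
  exact le_ciopt hc fun P hP =>
    arr_le_completion ((hP.cover (k, p)).2 ⟨Finset.mem_univ _, hp⟩) _

end CompleteInformation

theorem exists_reflTransGen_of_progress {α β : Type*} [LT β] [WellFoundedLT β]
    {r : α → α → Prop} {p final : α → Prop} (μ : α → β)
    (h : ∀ a, p a → ¬ final a → ∃ b, Relation.ReflTransGen r a b ∧ p b ∧ μ b < μ a) {a : α}
    (ha : p a) : ∃ b, Relation.ReflTransGen r a b ∧ final b := by
  induction hm : μ a using WellFoundedLT.induction generalizing a with
  | _ m ih =>
    by_cases hf : final a
    · exact ⟨a, .refl, hf⟩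
    · obtain ⟨b, hab, hb, hlt⟩ := h a ha hf
      obtain ⟨e, hbe, he⟩ := ih (μ b) (hm ▸ hlt) hb rfl
      exact ⟨e, hab.trans hbe, he⟩

section Noninterventionist

variable {w : Warehouse} {n c : ℕ} {I : Instance n} {X : Set Pt} {s s' : NState n}

theorem IsPreplan.replan {K A : Finset (Fin n)} {done R P : List (Tour n)}
    (h : IsPreplan c (I.itemsOf K) (done ++ R)) (hKA : K ⊆ A)
    (hP : IsPreplan c ({x | x ∈ R.flatten} ∪ I.itemsOf (A \ K)) P) :
    IsPreplan c (I.itemsOf A) (done ++ P) := by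
  have hK : ∀ x, x ∈ done.flatten ∨ x ∈ R.flatten ↔ x ∈ I.itemsOf K := fun x => by
    rw [← h.cover, List.flatten_append, List.mem_append]
  convert h.left_of_append.append hP ?_ using 1
  · ext x
    have hx := hK x
    have hk := @hKA x.1
    simp only [Set.mem_union, Set.mem_ofPred_eq, Instance.itemsOf, Finset.mem_sdiff] at hx ⊢
    tauto
  · rintro x hx y (hy | hy)
    · exact h.fst_ne_of_append hx hy
    · exact fun hxy => (Finset.mem_sdiff.1 hy.1).2 (hxy ▸ ((hK x).1 (Or.inl hx)).1)

/-- An invariant of `NStep`: the batches that have been collected and those that are planned form a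
solution for the known orders, and the collected ones can be served by the present time. -/
structure NInvariant {n : ℕ} (w : Warehouse) (c : ℕ) (I : Instance n) (s : NState n) : Prop where
  time_nonneg : 0 ≤ s.time
  known_arrived : ∀ k ∈ s.known, I.arr k ≤ s.time
  exists_done : ∃ done, Dominates w 0 (done.foldl (serveBatch w .pcartN I.arr) (w.depot, 0))
    (w.depot, s.time) ∧ IsPreplan c (I.itemsOf s.known) (done ++ s.plan)

theorem NInvariant.initial : NInvariant w c I ⟨0, [], ∅⟩ where
  time_nonneg := le_rfl
  known_arrived := by simp
  exists_done := ⟨[], .refl w.walkable_depot, by simpa [Instance.itemsOf] using isPreplan_nil⟩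

theorem NInvariant.mem_itemsOf (h : NInvariant w c I s) {x : Item n} (hx : x ∈ s.plan.flatten) :
    x ∈ I.itemsOf s.known := by
  obtain ⟨done, -, hd⟩ := h.exists_done
  exact (hd.cover x).1 (by simp only [List.flatten_append, List.mem_append, hx, or_true])

theorem NInvariant.known_subset (h : NInvariant w c I s) : s.known ⊆ I.arrived s.time :=
  fun k hk => Instance.mem_arrived.2 (h.known_arrived k hk)

theorem NInvariant.todo_subset (h : NInvariant w c I s) (A : Finset (Fin n)) :
    {x | x ∈ s.plan.flatten} ∪ I.itemsOf A ⊆ I.itemsOf Finset.univ :=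
  Set.union_subset
    (fun _ hx => Instance.itemsOf_mono (Finset.subset_univ _) (h.mem_itemsOf hx))
    (Instance.itemsOf_mono (Finset.subset_univ A))

theorem NInvariant.wait (h : NInvariant w c I s) {t : ℝ} (ht : s.time ≤ t) :
    NInvariant w c I ⟨t, s.plan, s.known⟩ where
  time_nonneg := h.time_nonneg.trans ht
  known_arrived k hk := (h.known_arrived k hk).trans ht
  exists_done := by
    obtain ⟨done, hdone, hd⟩ := h.exists_done
    exact ⟨done, hdone.trans_walk w.walkable_depot (by simpa using ht), hd⟩

theorem NInvariant.batch (hI : I.LocsIn {p | w.Walkable p}) (h : NInvariant w c I s) {B : Tour n}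
    {P : List (Tour n)} (hplan : s.plan = B :: P) :
    NInvariant w c I
      ⟨completion w .pcartN (fun _ => 0) (w.depot, s.time) [B], P, s.known⟩ := by
  obtain ⟨done, hdone, hd⟩ := h.exists_done
  have hB : ∀ x ∈ B, x ∈ I.itemsOf s.known := fun x hx => h.mem_itemsOf (by simp [hplan, hx])
  have hle : s.time ≤ completion w .pcartN (fun _ => 0) (w.depot, s.time) [B] :=
    le_completion [B] (w.depot, s.time)
  refine ⟨h.time_nonneg.trans hle, fun k hk => (h.known_arrived k hk).trans hle, done ++ [B], ?_,
    by simpa [hplan] using hd⟩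
  have hserve : serve w I.arr B (w.depot, s.time) = serve w (fun _ => 0) B (w.depot, s.time) :=
    serve_congr_of_arrived (fun x hx => h.known_arrived _ (hB x hx).1) fun _ _ => h.time_nonneg
  have hdom := hdone.serveBatch (sys := .pcartN) (fun k => (add_zero (I.arr k)).ge)
    fun x hx => hI.mem (hB x hx)
  rw [serveBatch, serveBatch, hserve] at hdom
  rw [List.foldl_append]
  exact hdom

theorem NInvariant.step (hI : I.LocsIn {p | w.Walkable p}) (h : NInvariant w c I s)
    (hs : NStep w c I s s') : NInvariant w c I s' := by
  cases hs with
  | reopt P _ hP =>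
    obtain ⟨done, hdone, hd⟩ := h.exists_done
    exact ⟨h.time_nonneg, fun k hk => Instance.mem_arrived.1 hk, done, hdone,
      hd.replan h.known_subset hP.1.isPreplan⟩
  | batch B P hplan _ => exact h.batch hI hplan
  | idle k hplan _ hlt => exact hplan ▸ h.wait hlt.le

theorem NInvariant.of_reachable (hI : I.LocsIn {p | w.Walkable p})
    (hs : Relation.ReflTransGen (NStep w c I) ⟨0, [], ∅⟩ s) : NInvariant w c I s := by
  induction hs with
  | refl => exact .initial
  | tail _ hstep ih => exact ih.step hI hstep

theorem ciopt_le_of_isNReopt (hI : I.LocsIn {p | w.Walkable p}) {T : ℝ}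
    (hT : IsNReopt w c I T) : CIOPT w .pcartN c I ≤ T := by
  obtain ⟨done, hdone, hd⟩ := (NInvariant.of_reachable hI hT).exists_done
  rw [List.append_nil] at hd
  exact (ciopt_le hI hd).trans (hdone.time_le.trans_eq (add_zero T))

theorem NInvariant.exists_reopt (hc : 1 ≤ c) (h : NInvariant w c I s)
    (hnew : ∃ k, k ∉ s.known ∧ I.arr k ≤ s.time) :
    ∃ P, NStep w c I s ⟨s.time, P, I.arrived s.time⟩ := by
  obtain ⟨P, hP⟩ := exists_isOptimalPlan w .pcartN hc
    ((I.finite_itemsOf Finset.univ).subset (h.todo_subset (I.arrived s.time \ s.known)))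
  exact ⟨P, .reopt s P hnew hP⟩

theorem NInvariant.exists_progress (hI : I.LocsIn {p | w.Walkable p}) (hc : 1 ≤ c)
    (h : NInvariant w c I s) (hs : ¬ (s.plan = [] ∧ s.known = Finset.univ)) :
    ∃ s', Relation.ReflTransGen (NStep w c I) s s' ∧ NInvariant w c I s' ∧
      toLex (s'.knownᶜ.card, s'.plan.length) < toLex (s.knownᶜ.card, s.plan.length) := by
  by_cases hnew : ∃ k, k ∉ s.known ∧ I.arr k ≤ s.time
  · obtain ⟨P, hP⟩ := h.exists_reopt hc hnew
    exact ⟨_, .single hP, h.step hI hP,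
      Prod.Lex.left _ _ (Instance.card_compl_arrived_lt h.known_arrived hnew)⟩
  push Not at hnew
  cases hplan : s.plan with
  | cons B P =>
    exact ⟨_, .single (.batch s B P hplan fun k hk => (hnew k hk).le), h.batch hI hplan,
      Prod.Lex.right _ (Nat.lt_succ_self _)⟩
  | nil =>
    have hknown : ∃ k, k ∉ s.known := by
      by_contra! hall
      exact hs ⟨hplan, Finset.eq_univ_of_forall hall⟩
    obtain ⟨k, hk⟩ := Instance.exists_isNext (I := I) hknown
    have hidle : NStep w c I s ⟨I.arr k, [], s.known⟩ := .idle s k hplan hk (hnew k hk.1)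
    have h' := h.step hI hidle
    obtain ⟨P, hP⟩ := h'.exists_reopt hc ⟨k, hk.1, le_rfl⟩
    exact ⟨_, .tail (.single hidle) hP, h'.step hI hP,
      Prod.Lex.left _ _ (Instance.card_compl_arrived_lt h'.known_arrived ⟨k, hk.1, le_rfl⟩)⟩

theorem exists_isNReopt (hI : I.LocsIn {p | w.Walkable p}) (hc : 1 ≤ c) :
    ∃ T, IsNReopt w c I T := by
  obtain ⟨⟨T, _, _⟩, hT, rfl, rfl⟩ := exists_reflTransGen_of_progress
    (final := fun s : NState n => s.plan = [] ∧ s.known = Finset.univ)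
    (fun s : NState n => toLex (s.knownᶜ.card, s.plan.length))
    (fun _ h => h.exists_progress hI hc) (NInvariant.initial (w := w) (c := c) (I := I))
  exact ⟨T, hT⟩

theorem completion_append_pcartN {arr : Fin n → ℝ} (P P' : List (Tour n)) (t : ℝ) :
    completion w .pcartN arr (w.depot, t) (P ++ P') =
      completion w .pcartN arr (w.depot, completion w .pcartN arr (w.depot, t) P) P' := by
  have h : (P.foldl (serveBatch w .pcartN arr) (w.depot, t)).1 = w.depot := by
    induction P using List.reverseRecOn with
    | nil => rfl
    | append_singleton => rw [List.foldl_append]; rfl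
  rw [completion, List.foldl_append, completion, completion]
  exact congrArg (fun p => (P'.foldl (serveBatch w .pcartN arr) p).2) (Prod.ext h rfl)

theorem IsOptimalPlan.completion_le_of_perm {Q : Set (Item n)} {P : List (Tour n)}
    (h : IsOptimalPlan w .pcartN c Q P) {B B' : Tour n} (hB : B ∈ P) (hB' : B'.Perm B) :
    completion w .pcartN (fun _ => 0) (w.depot, 0) [B] ≤
      completion w .pcartN (fun _ => 0) (w.depot, 0) [B'] := by
  obtain ⟨P₁, P₂, rfl⟩ := List.append_of_mem hB
  have hplan : IsPlan c Q (P₁ ++ B' :: P₂) := by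
    refine h.1.of_perm ?_ ?_
    · simpa using (hB'.append_right _).append_left _
    · simp [ordersOf, List.toFinset_eq_of_perm _ _ (hB'.map Prod.fst)]
  have hsplit : ∀ C : Tour n, completion w .pcartN (fun _ => 0) (w.depot, 0) (P₁ ++ C :: P₂) =
      completion w .pcartN (fun _ => 0) (w.depot, 0) P₂ +
        (completion w .pcartN (fun _ => 0) (w.depot, 0) [C] +
          completion w .pcartN (fun _ => 0) (w.depot, 0) P₁) := fun C => by
    have h₁ : 0 ≤ completion w .pcartN (fun _ => 0) (w.depot, 0) P₁ := le_completion P₁ (w.depot, 0)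
    have hC : 0 ≤ completion w .pcartN (fun _ => 0) (w.depot, 0) [C] :=
      le_completion [C] (w.depot, 0)
    rw [completion_append_pcartN, ← List.singleton_append, completion_append_pcartN,
      completion_zero_eq_add [C] _ h₁, completion_zero_eq_add P₂ _ (add_nonneg hC h₁)]
  have hle := h.2 _ hplan
  rw [hsplit, hsplit] at hle
  linarith

variable {C R : ℝ}

theorem IsOptimalPlan.completion_singleton_le (hX : IsTourRegion w X C) {Q : Set (Item n)}
    {P : List (Tour n)} (h : IsOptimalPlan w .pcartN c Q P) (hQ : ∀ x ∈ Q, x.2 ∈ X) {B : Tour n}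
    (hB : B ∈ P) : completion w .pcartN (fun _ => 0) (w.depot, 0) [B] ≤ 2 * C := by
  have hBX : ∀ x ∈ B, x.2 ∈ X := fun x hx => hQ x ((h.1.cover x).1 (List.mem_flatten_of_mem hB hx))
  obtain ⟨B', hperm, hB'⟩ := hX.exists_perm_serve_le B hBX
  refine (h.completion_le_of_perm hB hperm).trans ?_
  rw [two_mul]
  exact add_le_add (hB' _ hX.depot_mem) (hX.d_le _ (serve_fst_mem
    (fun x hx => hBX x (hperm.mem_iff.1 hx)) hX.depot_mem) _ hX.depot_mem)

theorem completion_singleton_le_of_reachable (hX : IsTourRegion w X C) (hI : I.LocsIn X)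
    (hs : Relation.ReflTransGen (NStep w c I) ⟨0, [], ∅⟩ s) :
    ∀ B ∈ s.plan, completion w .pcartN (fun _ => 0) (w.depot, 0) [B] ≤ 2 * C := by
  induction hs with
  | refl => simp
  | tail hs hstep ih =>
    cases hstep with
    | reopt P _ hP =>
      exact fun B => hP.completion_singleton_le hX fun x hx =>
        hI.mem ((NInvariant.of_reachable (hI.mono hX.walkable) hs).todo_subset _ hx)
    | batch B P hplan _ => exact fun B' hB' => ih B' (by simp [hplan, hB'])
    | idle => simp

theorem time_le_of_reachable_of_notMem_known (hX : IsTourRegion w X C) (hI : I.LocsIn X)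
    (hR0 : 0 ≤ R) (hR : ∀ k, I.arr k ≤ R)
    (hs : Relation.ReflTransGen (NStep w c I) ⟨0, [], ∅⟩ s) {k : Fin n} (hk : k ∉ s.known) :
    s.time ≤ R + 2 * C := by
  have hC := hX.nonneg
  induction hs with
  | refl => positivity
  | tail hs hstep ih =>
    have hinv := NInvariant.of_reachable (hI.mono hX.walkable) hs
    cases hstep with
    | reopt P _ hP => exact ih fun hmem => hk (hinv.known_subset hmem)
    | batch B P hplan hold =>
      have hB := completion_singleton_le_of_reachable hX hI hs B (by simp [hplan])
      dsimp only
      rw [completion_zero_eq_add _ _ hinv.time_nonneg]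
      linarith [hold k hk, hR k]
    | idle k' => linarith [hR k']

theorem completion_plan_le_of_known_eq_univ (hX : IsTourRegion w X C) (hI : I.LocsIn X)
    (hR0 : 0 ≤ R) (hR : ∀ k, I.arr k ≤ R) {P₀ : List (Tour n)}
    (hP₀ : IsPlan c (I.itemsOf Finset.univ) P₀)
    (hs : Relation.ReflTransGen (NStep w c I) ⟨0, [], ∅⟩ s) (hknown : s.known = Finset.univ) :
    completion w .pcartN (fun _ => 0) (w.depot, s.time) s.plan ≤
      R + completion w .pcartN (fun _ => 0) (w.depot, 0) P₀ + 2 * C := by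
  have hIw := hI.mono hX.walkable
  induction hs with
  | refl =>
    have hC := hX.nonneg
    have h₀ : 0 ≤ completion w .pcartN (fun _ => 0) (w.depot, 0) P₀ :=
      le_completion P₀ (w.depot, 0)
    change (0 : ℝ) ≤ _
    positivity
  | @tail s _ hs hstep ih =>
    have hinv := NInvariant.of_reachable hIw hs
    cases hstep with
    | reopt P hnew hP =>
      obtain ⟨k, hk, -⟩ := hnew
      obtain ⟨P', hP', hle⟩ := hP₀.isPreplan.exists_isPlan_completion_le (sys := .pcartN)
        (fun _ => hIw.mem) (hinv.todo_subset (I.arrived s.time \ s.known))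
        (fun _ => (add_zero (0 : ℝ)).ge) (Dominates.refl (s := (w.depot, 0)) w.walkable_depot)
      have hopt := hP.2 P' hP'
      have htime := time_le_of_reachable_of_notMem_known hX hI hR0 hR hs hk
      dsimp only
      rw [completion_zero_eq_add P _ hinv.time_nonneg]
      linarith
    | batch B P hplan _ =>
      have h := ih hknown
      rwa [hplan, ← List.singleton_append, completion_append_pcartN] at h
    | idle k _ hk => exact absurd (hknown ▸ Finset.mem_univ k) hk.1

theorem isNReopt_le (hX : IsTourRegion w X C) (hI : I.LocsIn X) (hR0 : 0 ≤ R)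
    (hR : ∀ k, I.arr k ≤ R) {P₀ : List (Tour n)} (hP₀ : IsPlan c (I.itemsOf Finset.univ) P₀)
    {T : ℝ} (hT : IsNReopt w c I T) :
    T ≤ R + completion w .pcartN (fun _ => 0) (w.depot, 0) P₀ + 2 * C :=
  completion_plan_le_of_known_eq_univ hX hI hR0 hR hP₀ hT rfl

end Noninterventionist

section Interventionist

variable {w : Warehouse} {sys : PickingSystem} {n c : ℕ} {I : Instance n} {X : Set Pt} {C R : ℝ}
  {s s' : IState n}

theorem IsReplan.isPreplan {Q : Set (Item n)} {picked cur : Tour n} {fut : List (Tour n)}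
    (h : IsReplan c (ordersOf picked) Q cur fut) (hnd : picked.Nodup)
    (hdisj : ∀ x ∈ picked, x ∉ Q) :
    IsPreplan c ({x | x ∈ picked} ∪ Q) ((picked ++ cur) :: fut) where
  nodup := by
    rw [List.flatten_cons, List.append_assoc, List.nodup_append']
    exact ⟨hnd, h.nodup, fun x hx hx' => hdisj x hx ((h.cover x).1 hx')⟩
  cover x := by
    rw [List.flatten_cons, List.append_assoc, List.mem_append, h.cover]
    rfl
  capacity := by
    rw [List.forall_mem_cons, ordersOf_append]
    exact ⟨h.capacity_cur, h.capacity_fut⟩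
  unsplit := by
    have hcur := List.pairwise_cons.1 h.unsplit
    refine List.pairwise_cons.2 ⟨fun B hB => ?_, hcur.2⟩
    rw [ordersOf_append, Finset.disjoint_union_left]
    refine ⟨Finset.disjoint_left.2 fun k hk hk' => ?_, hcur.1 B hB⟩
    obtain ⟨y, hy, rfl⟩ := mem_ordersOf.1 hk'
    have hyf := List.mem_flatten_of_mem hB hy
    have hyQ : y ∈ Q := (h.cover y).1 (List.mem_append_right _ hyf)
    exact List.disjoint_of_nodup_append h.nodup (h.commit y hyQ hk) hyf

/-- An invariant of `IStep`: the batches that have been collected, the current batch and the planned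
ones form a solution for the known orders, the items collected so far can be collected by the
present time, no arrival has been ignored, and the picker is in the region `X`. -/
structure IInvariant {n : ℕ} (w : Warehouse) (sys : PickingSystem) (c : ℕ) (X : Set Pt)
    (I : Instance n) (s : IState n) : Prop where
  time_nonneg : 0 ≤ s.time
  pos_mem : s.pos ∈ X
  known_arrived : ∀ k ∈ s.known, I.arr k ≤ s.time
  not_passed : ∀ k, k ∉ s.known → s.time ≤ I.arr k
  exists_done : ∃ done picked, ordersOf picked = s.cart ∧
    Dominates w 0 (serve w I.arr picked (done.foldl (serveBatch w sys I.arr) (w.depot, 0)))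
      (s.pos, s.time) ∧
    IsPreplan c (I.itemsOf s.known) (done ++ (picked ++ s.cur) :: s.fut)

theorem IInvariant.initial (hX : IsTourRegion w X C) (harr : ∀ k, 0 ≤ I.arr k) :
    IInvariant w sys c X I ⟨0, w.depot, ∅, [], [], ∅⟩ where
  time_nonneg := le_rfl
  pos_mem := hX.depot_mem
  known_arrived := by simp
  not_passed k _ := harr k
  exists_done := by
    refine ⟨[], [], rfl, .refl w.walkable_depot, ?_⟩
    simpa [Instance.itemsOf] using isPreplan_singleton (c := c) List.nodup_nil (by simp [ordersOf])

theorem IInvariant.mem_itemsOf (h : IInvariant w sys c X I s) {x : Item n}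
    (hx : x ∈ s.cur ++ s.fut.flatten) : x ∈ I.itemsOf s.known := by
  obtain ⟨done, picked, -, -, hd⟩ := h.exists_done
  refine (hd.cover x).1 ?_
  simp only [List.flatten_append, List.flatten_cons, List.mem_append] at hx ⊢
  tauto

theorem IInvariant.mem_itemsOf_of_cur_eq (h : IInvariant w sys c X I s) {x : Item n} {B : Tour n}
    (hcur : s.cur = x :: B) : x ∈ I.itemsOf s.known :=
  h.mem_itemsOf (by simp [hcur])

theorem IInvariant.known_subset (h : IInvariant w sys c X I s) : s.known ⊆ I.arrived s.time :=
  fun k hk => Instance.mem_arrived.2 (h.known_arrived k hk)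

theorem IInvariant.todo_subset (h : IInvariant w sys c X I s) (A : Finset (Fin n)) :
    {x | x ∈ s.cur ++ s.fut.flatten} ∪ I.itemsOf A ⊆ I.itemsOf Finset.univ :=
  Set.union_subset
    (fun _ hx => Instance.itemsOf_mono (Finset.subset_univ _) (h.mem_itemsOf hx))
    (Instance.itemsOf_mono (Finset.subset_univ A))

theorem IInvariant.card_cart_le (h : IInvariant w sys c X I s) : s.cart.card ≤ c := by
  obtain ⟨done, picked, hcart, -, hd⟩ := h.exists_done
  refine le_trans (Finset.card_le_card ?_) (hd.capacity (picked ++ s.cur) (by simp))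
  rw [ordersOf_append, hcart]
  exact Finset.subset_union_left

theorem IInvariant.dest_mem (hX : IsTourRegion w X C) (hI : I.LocsIn X)
    (h : IInvariant w sys c X I s) : s.dest w sys ∈ X := by
  cases hcur : s.cur with
  | nil => simpa only [IState.dest, hcur] using batchEnd_mem hX.depot_mem h.pos_mem
  | cons x B => simpa only [IState.dest, hcur] using hI.mem (h.mem_itemsOf_of_cur_eq hcur)

theorem IInvariant.reopt (h : IInvariant w sys c X I s) {cur : Tour n} {fut : List (Tour n)}
    (hP : IsReplan c s.cart
      ({x | x ∈ s.cur ++ s.fut.flatten} ∪ I.itemsOf (I.arrived s.time \ s.known)) cur fut) :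
    IInvariant w sys c X I ⟨s.time, s.pos, s.cart, cur, fut, I.arrived s.time⟩ := by
  obtain ⟨done, picked, hcart, hdom, hd⟩ := h.exists_done
  refine ⟨h.time_nonneg, h.pos_mem, fun k hk => Instance.mem_arrived.1 hk,
    fun k hk => le_of_not_ge fun hle => hk (Instance.mem_arrived.2 hle), done, picked, hcart, hdom,
    hd.replan h.known_subset ?_⟩
  have hnd := hd.nodup
  rw [List.flatten_append, List.flatten_cons, List.append_assoc] at hnd
  have hnd' := List.nodup_append'.1 (List.nodup_append'.1 hnd).2.1
  convert (hcart ▸ hP).isPreplan hnd'.1 ?_ using 1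
  · ext x
    simp only [Set.mem_union, Set.mem_ofPred_eq, List.flatten_cons, List.mem_append]
    tauto
  · rintro x hx (hx' | hx')
    · exact hnd'.2.2 hx hx'
    · have hK : x ∈ I.itemsOf s.known := (hd.cover x).1 (by simp [hx])
      exact (Finset.mem_sdiff.1 hx'.1).2 hK.1

theorem IInvariant.move (hX : IsTourRegion w X C) (h : IInvariant w sys c X I s) {p : Pt}
    (hp : p ∈ X) {t : ℝ} (hpt : s.time + w.d s.pos p ≤ t)
    (ht : ∀ k, k ∉ s.known → t ≤ I.arr k) :
    IInvariant w sys c X I ⟨t, p, s.cart, s.cur, s.fut, s.known⟩ := by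
  have hle : s.time ≤ t := (le_add_of_nonneg_right (w.d_nonneg _ _)).trans hpt
  obtain ⟨done, picked, hcart, hdom, hd⟩ := h.exists_done
  exact ⟨h.time_nonneg.trans hle, hp, fun k hk => (h.known_arrived k hk).trans hle, ht,
    done, picked, hcart, hdom.trans_walk (hX.walkable p hp) hpt, hd⟩

theorem IInvariant.pick (hX : IsTourRegion w X C) (hI : I.LocsIn X) (h : IInvariant w sys c X I s)
    {x : Item n} {B : Tour n} (hcur : s.cur = x :: B)
    (ht : ∀ k, k ∉ s.known → s.time + w.d s.pos x.2 ≤ I.arr k) :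
    IInvariant w sys c X I
      ⟨s.time + w.d s.pos x.2, x.2, insert x.1 s.cart, B, s.fut, s.known⟩ := by
  have hx := h.mem_itemsOf_of_cur_eq hcur
  have hmove := h.move hX (hI.mem hx) le_rfl ht
  obtain ⟨done, picked, hcart, hdom, hd⟩ := hmove.exists_done
  refine ⟨hmove.time_nonneg, hmove.pos_mem, hmove.known_arrived, ht, done, picked ++ [x], ?_, ?_,
    by simpa [hcur] using hd⟩
  · rw [ordersOf_append, hcart, Finset.union_comm]
    simp [ordersOf]
  · rw [serve_append]
    refine ⟨hdom.right, hdom.right, ?_⟩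
    simp only [serve, Warehouse.d_self, add_zero]
    exact max_le (hdom.le.trans_eq (add_zero _)) (hmove.known_arrived _ hx.1)

theorem IInvariant.close (hX : IsTourRegion w X C) (h : IInvariant w sys c X I s)
    (hcur : s.cur = [])
    (ht : ∀ k, k ∉ s.known → s.time + w.d s.pos (batchEnd w sys s.pos) ≤ I.arr k) :
    IInvariant w sys c X I ⟨s.time + w.d s.pos (batchEnd w sys s.pos), batchEnd w sys s.pos, ∅,
      s.fut.headD [], s.fut.tail, s.known⟩ := by
  have hmove := h.move hX (batchEnd_mem hX.depot_mem h.pos_mem) le_rfl ht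
  obtain ⟨done, picked, -, hdom, hd⟩ := h.exists_done
  refine ⟨hmove.time_nonneg, hmove.pos_mem, hmove.known_arrived, ht, done ++ [picked], [], rfl,
    ?_, ?_⟩
  · rw [List.foldl_append]
    exact hdom.batchEnd
  · rw [hcur, List.append_nil] at hd
    cases hfut : s.fut with
    | nil =>
      have hnil : IsPreplan c {x | x ∈ ([] : Tour n)} [[]] :=
        isPreplan_singleton List.nodup_nil (by simp [ordersOf])
      simpa [hfut] using hd.append hnil (by simp)
    | cons B P => simpa [hfut] using hd

theorem IInvariant.step (hX : IsTourRegion w X C) (hI : I.LocsIn X)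
    (h : IInvariant w sys c X I s) (hs : IStep w sys c I s s') : IInvariant w sys c X I s' := by
  cases hs with
  | reopt cur fut _ hP => exact h.reopt hP.1
  | walk k p hk _ _ hp hp₁ hp₂ =>
    exact h.move hX (hX.mem_of_between _ h.pos_mem _ (h.dest_mem hX hI) p hp hp₂)
      (by rw [hp₁, add_sub_cancel]) hk.2
  | pick x B hcur ht => exact h.pick hX hI hcur ht
  | close hcur _ ht => exact h.close hX hcur ht
  | idle k _ hk ht => exact h.move hX h.pos_mem (by simpa using ht.le) hk.2

theorem IInvariant.of_reachable (hX : IsTourRegion w X C) (hI : I.LocsIn X)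
    (harr : ∀ k, 0 ≤ I.arr k)
    (hs : Relation.ReflTransGen (IStep w sys c I) ⟨0, w.depot, ∅, [], [], ∅⟩ s) :
    IInvariant w sys c X I s := by
  induction hs with
  | refl => exact .initial hX harr
  | tail _ hstep ih => exact ih.step hX hI hstep

theorem ciopt_le_of_isIReopt (hI : I.LocsIn {p | w.Walkable p}) (harr : ∀ k, 0 ≤ I.arr k) {T : ℝ}
    (hT : IsIReopt w sys c I T) : CIOPT w sys c I ≤ T := by
  obtain ⟨C, hX⟩ := exists_isTourRegion_walkable w
  obtain ⟨s, hs, ⟨hcur, hfut, -, hpos⟩, hk, rfl⟩ := hT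
  obtain ⟨done, picked, -, hdom, hd⟩ := (IInvariant.of_reachable hX hI harr hs).exists_done
  rw [hcur, hfut, List.append_nil, hk] at hd
  refine (ciopt_le hI hd).trans ?_
  rw [completion, List.foldl_append]
  simpa [serveBatch, ← hpos] using (hdom.batchEnd (sys := sys)).time_le

theorem IInvariant.exists_reopt (hc : 1 ≤ c) (h : IInvariant w sys c X I s)
    (hnew : ∃ k, k ∉ s.known ∧ I.arr k ≤ s.time) :
    ∃ cur fut, IStep w sys c I s ⟨s.time, s.pos, s.cart, cur, fut, I.arrived s.time⟩ := by
  obtain ⟨cur, fut, hP⟩ := exists_isOptimalReplan w sys hc s.pos h.card_cart_le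
    ((I.finite_itemsOf Finset.univ).subset (h.todo_subset (I.arrived s.time \ s.known)))
  exact ⟨cur, fut, .reopt s cur fut hnew hP⟩

open Classical in
/-- The number of picks and ends of batches that are still planned. -/
noncomputable def IState.remaining {n : ℕ} (w : Warehouse) (sys : PickingSystem) (s : IState n) :
    ℕ :=
  (s.cur ++ s.fut.flatten).length + s.fut.length + if s.Idle w sys then 0 else 1

theorem IState.remaining_le (s : IState n) :
    s.remaining w sys ≤ (s.cur ++ s.fut.flatten).length + s.fut.length + 1 :=
  Nat.add_le_add_left (by split_ifs <;> simp) _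

theorem IState.remaining_of_not_idle (hs : ¬ s.Idle w sys) :
    s.remaining w sys = (s.cur ++ s.fut.flatten).length + s.fut.length + 1 := by
  rw [IState.remaining, if_neg hs]

theorem IState.exists_step (c : ℕ) (hs : ¬ s.Idle w sys)
    (ht : ∀ k, k ∉ s.known → s.time + w.d s.pos (s.dest w sys) ≤ I.arr k) :
    ∃ s', IStep w sys c I s s' ∧ s'.known = s.known ∧ s'.remaining w sys < s.remaining w sys := by
  rw [IState.remaining_of_not_idle hs]
  cases hcur : s.cur with
  | cons x B =>
    refine ⟨_, .pick s x B hcur (by simpa only [IState.dest, hcur] using ht), rfl, ?_⟩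
    refine (IState.remaining_le _).trans_lt ?_
    simp
  | nil =>
    refine ⟨_, .close s hcur hs (by simpa only [IState.dest, hcur] using ht), rfl, ?_⟩
    cases hfut : s.fut with
    | nil =>
      rw [IState.remaining, if_pos ⟨rfl, rfl, rfl, (batchEnd_batchEnd _).symm⟩]
      simp
    | cons B P =>
      refine (IState.remaining_le _).trans_lt ?_
      simp

theorem IInvariant.exists_step_to_arrival (hX : IsTourRegion w X C) (hI : I.LocsIn X)
    (h : IInvariant w sys c X I s) {k : Fin n} (hk : I.IsNext s.known k) (hkt : s.time < I.arr k)
    (hidle : ¬ s.Idle w sys → I.arr k ≤ s.time + w.d s.pos (s.dest w sys)) :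
    ∃ s', IStep w sys c I s s' ∧ s'.known = s.known ∧ s'.time = I.arr k := by
  by_cases hs : s.Idle w sys
  · exact ⟨_, .idle s k hs hk hkt, rfl, rfl⟩
  · obtain ⟨p, hp, hp₁, hp₂⟩ := Warehouse.exists_between (hX.walkable _ h.pos_mem)
      (hX.walkable _ (h.dest_mem hX hI)) (t := I.arr k - s.time) (sub_nonneg.2 hkt.le)
      (sub_le_iff_le_add'.2 (hidle hs))
    exact ⟨_, .walk s k p hk hkt (hidle hs) hp hp₁ hp₂, rfl, rfl⟩

theorem IInvariant.exists_progress (hX : IsTourRegion w X C) (hI : I.LocsIn X) (hc : 1 ≤ c)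
    (h : IInvariant w sys c X I s) (hs : ¬ (s.Idle w sys ∧ s.known = Finset.univ)) :
    ∃ s', Relation.ReflTransGen (IStep w sys c I) s s' ∧ IInvariant w sys c X I s' ∧
      toLex (s'.knownᶜ.card, s'.remaining w sys) <
        toLex (s.knownᶜ.card, s.remaining w sys) := by
  by_cases hnew : ∃ k, k ∉ s.known ∧ I.arr k ≤ s.time
  · obtain ⟨cur, fut, hP⟩ := h.exists_reopt hc hnew
    exact ⟨_, .single hP, h.step hX hI hP,
      Prod.Lex.left _ _ (Instance.card_compl_arrived_lt h.known_arrived hnew)⟩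
  by_cases hstep : ¬ s.Idle w sys ∧
      ∀ k, k ∉ s.known → s.time + w.d s.pos (s.dest w sys) ≤ I.arr k
  · obtain ⟨s', hs', hknown, hlt⟩ := IState.exists_step c hstep.1 hstep.2
    exact ⟨s', .single hs', h.step hX hI hs', hknown ▸ Prod.Lex.right _ hlt⟩
  push Not at hnew hstep
  obtain ⟨k, hk⟩ := Instance.exists_isNext (I := I) (A := s.known) <| by
    by_contra! hall
    by_cases hidle : s.Idle w sys
    · exact hs ⟨hidle, Finset.eq_univ_of_forall hall⟩
    · obtain ⟨k, hk, -⟩ := hstep hidle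
      exact hk (hall k)
  obtain ⟨s₁, hs₁, hknown, htime⟩ := h.exists_step_to_arrival hX hI hk (hnew k hk.1) fun hidle => by
    obtain ⟨m, hm, hlt⟩ := hstep hidle
    exact (hk.2 m hm).trans hlt.le
  have h₁ := h.step hX hI hs₁
  have hnew₁ : ∃ k, k ∉ s₁.known ∧ I.arr k ≤ s₁.time := ⟨k, hknown ▸ hk.1, htime.ge⟩
  obtain ⟨cur, fut, hP⟩ := h₁.exists_reopt hc hnew₁
  exact ⟨_, .tail (.single hs₁) hP, h₁.step hX hI hP,
    hknown ▸ Prod.Lex.left _ _ (Instance.card_compl_arrived_lt h₁.known_arrived hnew₁)⟩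

theorem exists_isIReopt (hI : I.LocsIn {p | w.Walkable p}) (harr : ∀ k, 0 ≤ I.arr k)
    (hc : 1 ≤ c) : ∃ T, IsIReopt w sys c I T := by
  obtain ⟨C, hX⟩ := exists_isTourRegion_walkable w
  obtain ⟨s, hs, hidle, hk⟩ := exists_reflTransGen_of_progress
    (final := fun s : IState n => s.Idle w sys ∧ s.known = Finset.univ)
    (fun s : IState n => toLex (s.knownᶜ.card, s.remaining w sys))
    (fun _ h => h.exists_progress hX hI hc) (IInvariant.initial (sys := sys) (c := c) hX harr)
  exact ⟨s.time, s, hs, hidle, hk, rfl⟩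

theorem IsOptimalReplan.completion_le (hX : IsTourRegion w X C) (hI : I.LocsIn X)
    {P₀ : List (Tour n)} (hP₀ : IsPlan c (I.itemsOf Finset.univ) P₀) {p : Pt} (hp : p ∈ X)
    {cart : Finset (Fin n)} (hcart : cart.card ≤ c) {Q : Set (Item n)}
    (hQ : Q ⊆ I.itemsOf Finset.univ) {cur : Tour n} {fut : List (Tour n)}
    (h : IsOptimalReplan w sys c p cart Q cur fut) :
    completion w sys (fun _ => 0) (p, 0) (cur :: fut) ≤
      completion w sys (fun _ => 0) (w.depot, 0) P₀ + 3 * C := by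
  classical
  have hQfin : Q.Finite := (I.finite_itemsOf Finset.univ).subset hQ
  obtain ⟨B, hperm, hB⟩ := hX.exists_perm_serve_le
    (hQfin.toFinset.filter fun x => x.1 ∈ cart).toList fun x hx => by
      simp only [Finset.mem_toList, Finset.mem_filter, Set.Finite.mem_toFinset] at hx
      exact hI.mem (hQ hx.1)
  have hmem : ∀ x, x ∈ B ↔ x ∈ Q ∧ x.1 ∈ cart := fun x => by rw [hperm.mem_iff]; simp
  have hserve : (serve w (fun _ => 0) B (p, 0)).1 ∈ X :=
    serve_fst_mem (fun x hx => hI.mem (hQ ((hmem x).1 hx).1)) hp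
  have hend := batchEnd_mem (sys := sys) hX.depot_mem hserve
  have hdom : Dominates w (3 * C) (serveBatch w sys (fun _ => 0) (p, 0) B) (w.depot, 0) := by
    refine ⟨hX.walkable _ hend, w.walkable_depot, ?_⟩
    simp only [serveBatch]
    linarith [hB p hp, hX.d_le _ hserve _ hend, hX.d_le _ hend _ hX.depot_mem]
  obtain ⟨P', hP', hle⟩ := hP₀.isPreplan.exists_isPlan_completion_le (sys := sys)
    (arr := fun _ => 0) (arr' := fun _ => 0) (Q' := {x | x ∈ Q ∧ x.1 ∉ cart})
    (fun _ => (hI.mono hX.walkable).mem) (fun x hx => hQ hx.1)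
    (fun _ => by linarith [hX.nonneg]) hdom
  exact (h.2 B P' (isReplan_of_isPlan hcart (hperm.nodup_iff.2 (Finset.nodup_toList _)) hmem
    hP')).trans hle

theorem IInvariant.completion_pick (h : IInvariant w sys c X I s) {x : Item n} {B : Tour n}
    (hcur : s.cur = x :: B) :
    completion w sys (fun _ => 0) (x.2, s.time + w.d s.pos x.2) (B :: s.fut) =
      completion w sys (fun _ => 0) (s.pos, s.time) (s.cur :: s.fut) := by
  rw [hcur]
  simp only [completion, List.foldl_cons, serveBatch, serve,
    max_eq_left (add_nonneg h.time_nonneg (w.d_nonneg s.pos x.2))]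

theorem IState.completion_close (hcur : s.cur = []) :
    completion w sys (fun _ => 0)
        (batchEnd w sys s.pos, s.time + w.d s.pos (batchEnd w sys s.pos))
        (s.fut.headD [] :: s.fut.tail) =
      completion w sys (fun _ => 0) (s.pos, s.time) (s.cur :: s.fut) := by
  rw [hcur]
  cases s.fut with
  | nil => simp [completion, serveBatch, serve, batchEnd_batchEnd]
  | cons B P => rfl

theorem completion_cur_fut_le_of_known_eq_univ (hX : IsTourRegion w X C) (hI : I.LocsIn X)
    (harr : ∀ k, 0 ≤ I.arr k) (hR0 : 0 ≤ R) (hR : ∀ k, I.arr k ≤ R) {P₀ : List (Tour n)}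
    (hP₀ : IsPlan c (I.itemsOf Finset.univ) P₀)
    (hs : Relation.ReflTransGen (IStep w sys c I) ⟨0, w.depot, ∅, [], [], ∅⟩ s)
    (hknown : s.known = Finset.univ) :
    completion w sys (fun _ => 0) (s.pos, s.time) (s.cur :: s.fut) ≤
      R + completion w sys (fun _ => 0) (w.depot, 0) P₀ + 3 * C := by
  induction hs with
  | refl =>
    have hC := hX.nonneg
    have h₀ : 0 ≤ completion w sys (fun _ => 0) (w.depot, 0) P₀ := le_completion P₀ (w.depot, 0)
    have hnil : completion w sys (fun _ : Fin n => 0) (w.depot, 0) [[]] = 0 := by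
      cases sys <;> simp [completion, serveBatch, serve, batchEnd]
    rw [hnil]
    positivity
  | tail hs hstep ih =>
    have hinv := IInvariant.of_reachable hX hI harr hs
    cases hstep with
    | reopt cur fut hnew hP =>
      obtain ⟨k, hk, -⟩ := hnew
      have hopt := hP.completion_le hX hI hP₀ hinv.pos_mem hinv.card_cart_le (hinv.todo_subset _)
      rw [completion_zero_eq_add _ _ hinv.time_nonneg]
      linarith [hinv.not_passed k hk, hR k]
    | walk k p hk => exact absurd (hknown ▸ Finset.mem_univ k) hk.1
    | pick x B hcur _ => exact (hinv.completion_pick hcur).trans_le (ih hknown)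
    | close hcur => exact (IState.completion_close hcur).trans_le (ih hknown)
    | idle k _ hk => exact absurd (hknown ▸ Finset.mem_univ k) hk.1

theorem isIReopt_le (hX : IsTourRegion w X C) (hI : I.LocsIn X) (harr : ∀ k, 0 ≤ I.arr k)
    (hR0 : 0 ≤ R) (hR : ∀ k, I.arr k ≤ R) {P₀ : List (Tour n)}
    (hP₀ : IsPlan c (I.itemsOf Finset.univ) P₀) {T : ℝ} (hT : IsIReopt w sys c I T) :
    T ≤ R + completion w sys (fun _ => 0) (w.depot, 0) P₀ + 3 * C := by
  obtain ⟨s, hs, -, hk, rfl⟩ := hT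
  exact (le_completion (s.cur :: s.fut) (s.pos, s.time)).trans
    (completion_cur_fut_le_of_known_eq_univ hX hI harr hR0 hR hP₀ hs hk)

end Interventionist

section Growth

variable {w : Warehouse} {sys : PickingSystem} {n c : ℕ} {I : Instance n} {arr : Fin n → ℝ}
  {s : Pt × ℝ}

/-- A lower bound for the duration of a batch that collects the locations `L`: a pushcart has to
reach every location from the depot, whereas a robot may start at any of them. The sup metric of
`Pt` bounds the walking distance from below. -/
noncomputable def minTime (w : Warehouse) (sys : PickingSystem) (L : Finset Pt) : ℝ :=
  match sys with
  | .robot => Metric.diam (L : Set Pt)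
  | _ => Metric.diam (insert w.depot (L : Set Pt))

theorem minTime_nonneg (L : Finset Pt) : 0 ≤ minTime w sys L := by
  cases sys <;> exact Metric.diam_nonneg

theorem add_dist_le_serve {B : Tour n} (hB : ∀ x ∈ B, w.Walkable x.2) (hs : w.Walkable s.1)
    {p q : Pt} (hp : p ∈ s.1 :: B.map Prod.snd) (hq : q ∈ s.1 :: B.map Prod.snd) :
    s.2 + dist p q ≤ (serve w arr B s).2 := by
  induction B generalizing s p q with
  | nil => simp_all [serve]
  | cons x B ih =>
    rw [List.forall_mem_cons] at hB
    let s' : Pt × ℝ := (x.2, max (s.2 + w.d s.1 x.2) (arr x.1))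
    change s.2 + dist p q ≤ (serve w arr B s').2
    have hstep : s.2 + dist s.1 x.2 ≤ s'.2 :=
      le_max_of_le_left (by gcongr; exact Warehouse.dist_le_d hs hB.1)
    have hih : ∀ p ∈ (x :: B).map Prod.snd, ∀ q ∈ (x :: B).map Prod.snd,
        s'.2 + dist p q ≤ (serve w arr B s').2 := fun p hp q hq => ih hB.2 hB.1 hp hq
    have hstart : ∀ q ∈ (x :: B).map Prod.snd, s.2 + dist s.1 q ≤ (serve w arr B s').2 :=
      fun q hq => by linarith [hih x.2 (by simp) q hq, dist_triangle s.1 x.2 q]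
    rcases List.mem_cons.1 hp with rfl | hp <;> rcases List.mem_cons.1 hq with rfl | hq
    · rw [dist_self, add_zero]
      exact le_serve (x :: B) s
    · exact hstart q hq
    · exact dist_comm p s.1 ▸ hstart p hp
    · linarith [hih p hp q hq, dist_nonneg (x := s.1) (y := x.2)]

theorem minTime_add_le_serveBatch {B : Tour n} (hB : ∀ x ∈ B, w.Walkable x.2) {L : Finset Pt}
    (hL : ∀ p ∈ L, p ∈ B.map Prod.snd) (hs : batchEnd w sys s.1 = s.1) (hsw : w.Walkable s.1) :
    minTime w sys L + s.2 ≤ (serveBatch w sys arr s B).2 := by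
  have hdiam : ∀ S : Set Pt, (∀ p ∈ S, p ∈ s.1 :: B.map Prod.snd) →
      Metric.diam S + s.2 ≤ (serveBatch w sys arr s B).2 := fun S hS =>
    le_trans (le_sub_iff_add_le.1 <| Metric.diam_le_of_forall_dist_le
      (sub_nonneg.2 (le_serve B s)) fun p hp q hq =>
        le_sub_iff_add_le'.2 (add_dist_le_serve hB hsw (hS p hp) (hS q hq)))
      (serve_le_serveBatch B s)
  have hinsert : ∀ p ∈ insert s.1 (L : Set Pt), p ∈ s.1 :: B.map Prod.snd := by
    rintro p (rfl | hp)
    exacts [List.mem_cons_self, List.mem_cons_of_mem _ (hL p hp)]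
  cases sys
  exacts [hdiam _ (hs.symm ▸ hinsert), hdiam _ (hs.symm ▸ hinsert),
    hdiam _ fun p hp => List.mem_cons_of_mem _ (hL p hp)]

theorem sum_minTime_le_mul_completion {P : List (Tour n)}
    (hP : ∀ B ∈ P, ∀ x ∈ B, w.Walkable x.2) (hcap : ∀ B ∈ P, (ordersOf B).card ≤ c)
    (hfull : ∀ B ∈ P, ∀ k ∈ ordersOf B, ∀ p ∈ I.locs k, (k, p) ∈ B)
    (hs : batchEnd w sys s.1 = s.1) (hsw : w.Walkable s.1) :
    ∑ k ∈ ordersOf P.flatten, minTime w sys (I.locs k) ≤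
      c * (completion w sys arr s P - s.2) := by
  induction P generalizing s with
  | nil => simp [completion, ordersOf]
  | cons B P ih =>
    rw [List.forall_mem_cons] at hP hcap hfull
    have hfst : ∑ k ∈ ordersOf B, minTime w sys (I.locs k) ≤
        c * ((serveBatch w sys arr s B).2 - s.2) := by
      refine (Finset.sum_le_card_nsmul _ _ _ fun k hk => le_sub_iff_add_le.2 <|
        minTime_add_le_serveBatch (arr := arr) hP.1 (fun p hp => ?_) hs hsw).trans ?_
      · exact List.mem_map_of_mem (f := Prod.snd) (hfull.1 k hk p hp)
      · rw [nsmul_eq_mul]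
        have := sub_nonneg.2 (le_serveBatch (w := w) (sys := sys) (arr := arr) B s)
        gcongr
        exact hcap.1
    have hrest := ih hP.2 hcap.2 hfull.2 (s := serveBatch w sys arr s B) (batchEnd_batchEnd _)
      (Warehouse.Walkable.batchEnd (serve_fst_mem (X := {p | w.Walkable p}) hP.1 hsw))
    have hunion := Finset.sum_union_inter (s₁ := ordersOf B) (s₂ := ordersOf P.flatten)
      (f := fun k => minTime w sys (I.locs k))
    have hinter : 0 ≤ ∑ k ∈ ordersOf B ∩ ordersOf P.flatten, minTime w sys (I.locs k) :=
      Finset.sum_nonneg fun _ _ => minTime_nonneg _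
    rw [List.flatten_cons, ordersOf_append]
    change _ ≤ c * (completion w sys arr (serveBatch w sys arr s B) P - s.2)
    linarith

theorem IsPlan.mem_of_mem_ordersOf {Q : Set (Item n)} {P : List (Tour n)} (hP : IsPlan c Q P)
    {B : Tour n} (hB : B ∈ P) {x : Item n} (hx : x ∈ Q) (hk : x.1 ∈ ordersOf B) : x ∈ B := by
  obtain ⟨B', hB', hx'⟩ := List.mem_flatten.1 ((hP.cover x).2 hx)
  have : Std.Symm fun B B' : Tour n => Disjoint (ordersOf B) (ordersOf B') :=
    ⟨fun _ _ h => h.symm⟩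
  by_contra hxB
  have hne : B ≠ B' := fun h => hxB (h ▸ hx')
  exact Finset.disjoint_left.1 (hP.unsplit.forall hB hB' hne) hk (mem_ordersOf.2 ⟨x, hx', rfl⟩)

theorem sum_minTime_le_mul_ciopt (hI : I.LocsIn {p | w.Walkable p})
    (hne : ∀ k, (I.locs k).Nonempty) (hc : 1 ≤ c) :
    ∑ k, minTime w sys (I.locs k) ≤ c * CIOPT w sys c I := by
  have hcpos : (0 : ℝ) < c := by exact_mod_cast hc
  rw [← div_le_iff₀' hcpos]
  refine le_ciopt hc fun P hP => (div_le_iff₀' hcpos).2 ?_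
  have hall : ordersOf P.flatten = Finset.univ := Finset.eq_univ_of_forall fun k => by
    obtain ⟨p, hp⟩ := hne k
    exact mem_ordersOf.2 ⟨(k, p), (hP.cover _).2 ⟨Finset.mem_univ _, hp⟩, rfl⟩
  have hsum := sum_minTime_le_mul_completion (I := I) (arr := I.arr) (sys := sys)
    (s := (w.depot, 0))
    (fun B hB x hx => hI.mem ((hP.cover x).1 (List.mem_flatten_of_mem hB hx))) hP.capacity
    (fun B hB k hk p hp => hP.mem_of_mem_ordersOf hB ⟨Finset.mem_univ _, hp⟩ hk)
    (by cases sys <;> rfl) w.walkable_depot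
  simpa [hall] using hsum

end Growth

section Reopt

variable {w : Warehouse} {sys : PickingSystem} {n c : ℕ} {I : Instance n} {X : Set Pt}
  {C R T : ℝ}

theorem exists_isReopt (hI : I.LocsIn {p | w.Walkable p}) (harr : ∀ k, 0 ≤ I.arr k)
    (hc : 1 ≤ c) : ∃ T, IsReopt w sys c I T := by
  cases sys
  exacts [exists_isNReopt hI hc, exists_isIReopt hI harr hc, exists_isIReopt hI harr hc]

theorem ciopt_le_of_isReopt (hI : I.LocsIn {p | w.Walkable p}) (harr : ∀ k, 0 ≤ I.arr k)
    (hT : IsReopt w sys c I T) : CIOPT w sys c I ≤ T := by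
  cases sys
  exacts [ciopt_le_of_isNReopt hI hT, ciopt_le_of_isIReopt hI harr hT,
    ciopt_le_of_isIReopt hI harr hT]

theorem isReopt_le (hX : IsTourRegion w X C) (hI : I.LocsIn X) (harr : ∀ k, 0 ≤ I.arr k)
    (hR0 : 0 ≤ R) (hR : ∀ k, I.arr k ≤ R) {P : List (Tour n)}
    (hP : IsPlan c (I.itemsOf Finset.univ) P) (hT : IsReopt w sys c I T) :
    T ≤ R + completion w sys (fun _ => 0) (w.depot, 0) P + 3 * C := by
  cases sys
  exacts [(isNReopt_le hX hI hR0 hR hP hT).trans (by linarith [hX.nonneg]),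
    isIReopt_le hX hI harr hR0 hR hP hT, isIReopt_le hX hI harr hR0 hR hP hT]

theorem isReopt_le_ciopt_add (hX : IsTourRegion w X C) (hI : I.LocsIn X) (hc : 1 ≤ c)
    (harr : ∀ k, 0 ≤ I.arr k) (hR0 : 0 ≤ R) (hR : ∀ k, I.arr k ≤ R) (hT : IsReopt w sys c I T) :
    T ≤ CIOPT w sys c I + R + 3 * C := by
  have hle : T - R - 3 * C ≤ CIOPT w sys c I := le_ciopt hc fun P hP => by
    obtain ⟨P', hP', hle⟩ := hP.isPreplan.exists_isPlan_completion_le (sys := sys)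
      (arr := fun _ => 0) (arr' := I.arr) (fun _ => (hI.mono hX.walkable).mem) subset_rfl
      (fun k => (harr k).trans_eq (add_zero _).symm)
      (Dominates.refl (s := (w.depot, 0)) w.walkable_depot)
    linarith [isReopt_le hX hI harr hR0 hR hP' hT]
  linarith

theorem completion_of_forall_eq_depot {P : List (Tour n)}
    (hP : ∀ B ∈ P, ∀ x ∈ B, x.2 = w.depot) :
    completion w sys (fun _ => 0) (w.depot, 0) P = 0 := by
  induction P with
  | nil => rfl
  | cons B P ih =>
    rw [List.forall_mem_cons] at hP
    have hend : batchEnd w sys w.depot = w.depot := by cases sys <;> rfl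
    have hB : serveBatch w sys (fun _ => 0) (w.depot, 0) B = (w.depot, 0) := by
      simp [serveBatch, serve_of_forall_eq hP.1, hend]
    simpa [completion, hB] using ih hP.2

theorem isReopt_le_of_locsIn_depot (hI : I.LocsIn {w.depot}) (hc : 1 ≤ c)
    (harr : ∀ k, 0 ≤ I.arr k) (hR0 : 0 ≤ R) (hR : ∀ k, I.arr k ≤ R) (hT : IsReopt w sys c I T) :
    T ≤ R := by
  obtain ⟨P, hP⟩ := exists_isPlan hc (I.finite_itemsOf Finset.univ)
  have hzero := completion_of_forall_eq_depot (w := w) (sys := sys) fun B hB x hx =>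
    hI.mem ((hP.cover x).1 (List.mem_flatten_of_mem hB hx))
  linarith [isReopt_le (isTourRegion_depot w) hI harr hR0 hR hP hT]

end Reopt

section Sequences

variable {w : Warehouse} {sys : PickingSystem} {n c : ℕ} {X : Set Pt} {o : ℕ → OrderTuple}
  {y : ℕ → ℝ} {T : ℕ → ℝ} {m : ℝ}

theorem mem_locSet {o : OrderTuple} {p : Pt} : p ∈ locSet o ↔ ∃ i, o.2 i = p := by
  simp [locSet]

theorem locSet_nonempty {o : OrderTuple} (ho : 1 ≤ o.1) : (locSet o).Nonempty :=
  ⟨o.2 ⟨0, ho⟩, mem_locSet.2 ⟨_, rfl⟩⟩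

theorem mkInstance_locsIn (ho : ∀ j i, (o j).2 i ∈ X) (y : ℕ → ℝ) :
    (mkInstance n o y).LocsIn X := by
  rintro k p hp
  obtain ⟨i, rfl⟩ := mem_locSet.1 hp
  exact ho k i

theorem forall_mkInstance_arr (p : ℝ → Prop) (o : ℕ → OrderTuple) (y : ℕ → ℝ) :
    (∀ k, p ((mkInstance n o y).arr k)) ↔ ∀ j < n, p (y j) :=
  ((Tuple.sort fun i : Fin n => y i).surjective.forall (p := fun i : Fin n => p (y i))).symm.trans
    Fin.forall_iff

theorem isLittleO_of_tendsto_sum_div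
    (h : Tendsto (fun n : ℕ => (∑ i ∈ Finset.range n, y i) / n) atTop (𝓝 m)) :
    y =o[atTop] fun n : ℕ => (n : ℝ) := by
  have hdiff := (((tendsto_add_atTop_iff_nat 1).2 h).div
    (tendsto_natCast_div_add_atTop (1 : ℝ)) one_ne_zero).sub h
  rw [div_one, sub_self] at hdiff
  have hne : ∀ᶠ n : ℕ in atTop, (n : ℝ) ≠ 0 := by
    filter_upwards [eventually_ne_atTop 0] with n hn using Nat.cast_ne_zero.2 hn
  refine (Asymptotics.isLittleO_iff_tendsto' (hne.mono fun n hn h => absurd h hn)).2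
    (hdiff.congr' ?_)
  filter_upwards [hne] with n hn
  simp only [Pi.div_apply, Finset.sum_range_succ, Nat.cast_succ]
  have : (n : ℝ) + 1 ≠ 0 := by positivity
  field_simp
  ring

theorem exists_pos_of_tendsto_sum_div (hm : 0 < m)
    (h : Tendsto (fun n : ℕ => (∑ i ∈ Finset.range n, y i) / n) atTop (𝓝 m)) :
    ∃ j, 0 < y j := by
  by_contra! hle
  exact hm.not_ge <| le_of_tendsto' h fun n =>
    div_nonpos_of_nonpos_of_nonneg (Finset.sum_nonpos fun i _ => hle i) n.cast_nonneg

theorem eventually_forall_lt_le_mul (h : y =o[atTop] fun n : ℕ => (n : ℝ)) {ε : ℝ} (hε : 0 < ε) :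
    ∀ᶠ n : ℕ in atTop, ∀ j < n, y j ≤ ε * n := by
  obtain ⟨N, hN⟩ := eventually_atTop.1 (h.bound hε)
  have hinit : ∀ᶠ n : ℕ in atTop, ∀ j ∈ Finset.range N, y j ≤ ε * n :=
    (Finset.eventually_all _).2 fun j _ =>
      (tendsto_natCast_atTop_atTop.const_mul_atTop hε).eventually_ge_atTop (y j)
  filter_upwards [hinit] with n hn j hj
  by_cases hjN : j < N
  · exact hn j (Finset.mem_range.2 hjN)
  · calc y j ≤ ε * ‖(j : ℝ)‖ := (le_abs_self _).trans (hN j (not_lt.1 hjN))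
      _ = ε * j := by rw [Real.norm_natCast]
      _ ≤ ε * n := by gcongr

theorem exists_isReopt_mkInstance (hwalk : ∀ j i, w.Walkable ((o j).2 i)) (hc : 1 ≤ c)
    (hy : ∀ j, 0 ≤ y j) (n : ℕ) : ∃ T, IsReopt w sys c (mkInstance n o y) T :=
  exists_isReopt (mkInstance_locsIn hwalk y) ((forall_mkInstance_arr (0 ≤ ·) o y).2 fun j _ => hy j)
    hc

theorem isBigO_ciopt_of_tendsto_sum_minTime (hwalk : ∀ j i, w.Walkable ((o j).2 i))
    (hne : ∀ j, 1 ≤ (o j).1) (hc : 1 ≤ c) (hm : 0 < m)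
    (h : Tendsto (fun n : ℕ => (∑ j ∈ Finset.range n, minTime w sys (locSet (o j))) / n) atTop
      (𝓝 m)) :
    (fun n : ℕ => (n : ℝ)) =O[atTop] fun n => CIOPT w sys c (mkInstance n o y) := by
  refine .of_bound (2 * c / m) ?_
  filter_upwards [h.eventually (lt_mem_nhds (half_lt_self hm)), eventually_gt_atTop 0] with n hn hn0
  have hn0' : (0 : ℝ) < n := by exact_mod_cast hn0
  have hsum := sum_minTime_le_mul_ciopt (sys := sys) (I := mkInstance n o y)
    (mkInstance_locsIn hwalk y) (fun k => locSet_nonempty (hne k)) hc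
  change ∑ k : Fin n, minTime w sys (locSet (o k)) ≤ _ at hsum
  rw [Fin.sum_univ_eq_sum_range fun j => minTime w sys (locSet (o j))] at hsum
  rw [lt_div_iff₀ hn0'] at hn
  rw [Real.norm_natCast, div_mul_eq_mul_div, le_div_iff₀ hm]
  have habs := mul_le_mul_of_nonneg_left
    (Real.le_norm_self (CIOPT w sys c (mkInstance n o y))) c.cast_nonneg
  linarith

theorem isLittleO_sub_ciopt (hwalk : ∀ j i, w.Walkable ((o j).2 i)) (hc : 1 ≤ c)
    (hy : ∀ j, 0 ≤ y j) (hlast : y =o[atTop] fun n : ℕ => (n : ℝ))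
    (hT : ∀ n, IsReopt w sys c (mkInstance n o y) (T n)) :
    (T - fun n => CIOPT w sys c (mkInstance n o y)) =o[atTop] fun n : ℕ => (n : ℝ) := by
  obtain ⟨C, hX⟩ := exists_isTourRegion_walkable w
  refine .of_bound fun ε hε => ?_
  filter_upwards [eventually_forall_lt_le_mul hlast (half_pos hε),
    (tendsto_natCast_atTop_atTop.const_mul_atTop (half_pos hε)).eventually_ge_atTop (3 * C)]
    with n hlast hn
  have harr := (forall_mkInstance_arr (n := n) (0 ≤ ·) o y).2 fun j _ => hy j
  have hle := isReopt_le_ciopt_add hX (mkInstance_locsIn hwalk y) hc harr (by positivity)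
    ((forall_mkInstance_arr (· ≤ ε / 2 * n) o y).2 hlast) (hT n)
  have hge := ciopt_le_of_isReopt (mkInstance_locsIn hwalk y) harr (hT n)
  rw [Pi.sub_apply, Real.norm_of_nonneg (sub_nonneg.2 hge), Real.norm_natCast]
  linarith

theorem tendsto_reopt_div_ciopt_of_tendsto_sum_minTime (hwalk : ∀ j i, w.Walkable ((o j).2 i))
    (hne : ∀ j, 1 ≤ (o j).1) (hc : 1 ≤ c) (hy : ∀ j, 0 ≤ y j)
    (hlast : y =o[atTop] fun n : ℕ => (n : ℝ)) (hm : 0 < m)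
    (h : Tendsto (fun n : ℕ => (∑ j ∈ Finset.range n, minTime w sys (locSet (o j))) / n) atTop
      (𝓝 m)) (hT : ∀ n, IsReopt w sys c (mkInstance n o y) (T n)) :
    Tendsto (fun n => T n / CIOPT w sys c (mkInstance n o y)) atTop (𝓝 1) := by
  have hgrow := isBigO_ciopt_of_tendsto_sum_minTime (y := y) hwalk hne hc hm h
  have hS : ∀ᶠ n in atTop, CIOPT w sys c (mkInstance n o y) ≠ 0 := by
    filter_upwards [hgrow.eq_zero_imp, eventually_gt_atTop 0] with n hn hn0 hS
    exact hn0.ne' (by exact_mod_cast hn hS)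
  exact (Asymptotics.isEquivalent_iff_tendsto_one hS).1
    ((isLittleO_sub_ciopt hwalk hc hy hlast hT).trans_isBigO hgrow)

theorem tendsto_reopt_div_ciopt_of_locs_eq_depot (hdepot : ∀ j i, (o j).2 i = w.depot)
    (hne : ∀ j, 1 ≤ (o j).1) (hc : 1 ≤ c) (hy : ∀ j, 0 ≤ y j) (hpos : ∃ j, 0 < y j)
    (hT : ∀ n, IsReopt w sys c (mkInstance n o y) (T n)) :
    Tendsto (fun n => T n / CIOPT w sys c (mkInstance n o y)) atTop (𝓝 1) := by
  obtain ⟨j, hj⟩ := hpos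
  refine tendsto_const_nhds.congr' ?_
  filter_upwards [eventually_gt_atTop j] with n hn
  have hI : (mkInstance n o y).LocsIn {w.depot} := mkInstance_locsIn hdepot y
  have harr := (forall_mkInstance_arr (n := n) (0 ≤ ·) o y).2 fun j _ => hy j
  have : Nonempty (Fin n) := ⟨⟨j, hn⟩⟩
  obtain ⟨k, hk⟩ := Finite.exists_max (mkInstance n o y).arr
  have hupper := isReopt_le_of_locsIn_depot hI hc harr (harr k) hk (hT n)
  have hciopt := ciopt_le_of_isReopt (hI.mono (isTourRegion_depot w).walkable) harr (hT n)
  have hlower := arr_le_ciopt (w := w) (sys := sys) (I := mkInstance n o y) (k := k) hc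
    (locSet_nonempty (hne k))
  have hlast := hj.trans_le ((forall_mkInstance_arr (· ≤ _) o y).1 hk j hn)
  rw [(hupper.trans hlower).antisymm hciopt, div_self (hlast.trans_le hlower).ne']

end Sequences

section Random

variable {Ω : Type*} [MeasurableSpace Ω] {P : Measure Ω} {w : Warehouse} {sys : PickingSystem}

theorem measurable_diam_range {ι α β : Type*} [Countable ι] [MeasurableSpace α]
    [PseudoMetricSpace α] [OpensMeasurableSpace α] [SecondCountableTopology α]
    [MeasurableSpace β] {f : β → ι → α} (hf : ∀ i, Measurable fun b => f b i) :
    Measurable fun b => Metric.diam (Set.range (f b)) := by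
  simp only [Metric.diam, Metric.ediam, iSup_range]
  exact (Measurable.iSup fun i => .iSup fun j => (hf i).edist (hf j)).ennreal_toReal

theorem measurable_of_forall_sigmaMk {ι β : Type*} {α : ι → Type*} [∀ i, MeasurableSpace (α i)]
    [MeasurableSpace β] {f : (Σ i, α i) → β} (hf : ∀ i, Measurable fun x => f ⟨i, x⟩) :
    Measurable f :=
  fun _ hs => MeasurableSpace.measurableSet_iInf.2 fun i => hf i hs

theorem measurable_minTime (w : Warehouse) (sys : PickingSystem) :
    Measurable fun o : OrderTuple => minTime w sys (locSet o) := by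
  refine measurable_of_forall_sigmaMk fun k => ?_
  have hloc : ∀ x : Fin k → Pt, (locSet ⟨k, x⟩ : Set Pt) = Set.range x := by simp [locSet]
  have hcart : Measurable fun x : Fin k → Pt => Metric.diam (insert w.depot (Set.range x)) := by
    simp only [← Fin.range_cons]
    refine measurable_diam_range fun i => ?_
    cases i using Fin.cases
    exacts [measurable_const, measurable_pi_apply _]
  cases sys
  exacts [by simpa only [minTime, hloc] using hcart, by simpa only [minTime, hloc] using hcart,
    by simpa only [minTime, hloc] using measurable_diam_range measurable_pi_apply]

theorem minTime_le_diam {L : Finset Pt} (hL : ∀ p ∈ L, w.Walkable p) :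
    minTime w sys L ≤ Metric.diam {p | w.Walkable p} := by
  have hbdd := w.isCompact_setOf_walkable.isBounded
  have hinsert : insert w.depot (L : Set Pt) ⊆ {p | w.Walkable p} :=
    Set.insert_subset w.walkable_depot hL
  cases sys
  exacts [Metric.diam_mono hinsert hbdd, Metric.diam_mono hinsert hbdd, Metric.diam_mono hL hbdd]

theorem card_le_one_of_minTime_robot_eq_zero {L : Finset Pt} (h : minTime w .robot L = 0) :
    L.card ≤ 1 :=
  Finset.card_le_one.2 fun _ hp _ hq => dist_le_zero.1 <|
    (Metric.dist_le_diam_of_mem L.finite_toSet.isBounded hp hq).trans_eq h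

theorem eq_depot_of_minTime_eq_zero (hsys : sys ≠ .robot) {L : Finset Pt}
    (h : minTime w sys L = 0) {p : Pt} (hp : p ∈ L) : p = w.depot := by
  have hdiam : Metric.diam (insert w.depot (L : Set Pt)) = 0 := by
    cases sys
    exacts [h, h, absurd rfl hsys]
  exact dist_le_zero.1 <| (Metric.dist_le_diam_of_mem (L.finite_toSet.insert _).isBounded
    (Set.mem_insert_of_mem _ hp) (Set.mem_insert _ _)).trans_eq hdiam

theorem not_ae_card_le_one [IsProbabilityMeasure P] {O : Ω → OrderTuple}
    (h : 1 < ∫⁻ ω, ((locSet (O ω)).card : ℝ≥0∞) ∂P) :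
    ¬ ∀ᵐ ω ∂P, (locSet (O ω)).card ≤ 1 := fun hle => by
  refine h.not_ge ((lintegral_mono_ae (g := fun _ => 1) ?_).trans (by simp))
  filter_upwards [hle] with ω hω
  exact_mod_cast hω

theorem integral_pos_of_not_ae_eq_zero {f : Ω → ℝ} (hf : 0 ≤ᵐ[P] f) (hint : Integrable f P)
    (hne : ¬ f =ᵐ[P] 0) : 0 < ∫ ω, f ω ∂P :=
  (integral_nonneg_of_ae hf).lt_of_ne' fun h =>
    hne ((integral_eq_zero_iff_of_nonneg_ae hf hint).1 h)

theorem integrable_minTime [IsFiniteMeasure P] {O : Ω → OrderTuple} (hO : AEMeasurable O P)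
    (hwalk : ∀ᵐ ω ∂P, ∀ i, w.Walkable ((O ω).2 i)) :
    Integrable (fun ω => minTime w sys (locSet (O ω))) P := by
  refine .of_bound ((measurable_minTime w sys).comp_aemeasurable hO).aestronglyMeasurable
    (Metric.diam {p | w.Walkable p}) ?_
  filter_upwards [hwalk] with ω hω
  rw [Real.norm_of_nonneg (minTime_nonneg _)]
  refine minTime_le_diam fun p hp => ?_
  obtain ⟨i, rfl⟩ := mem_locSet.1 hp
  exact hω i

theorem ae_tendsto_sum_minTime [IsProbabilityMeasure P] {O : ℕ → Ω → OrderTuple}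
    (hwalk : ∀ᵐ ω ∂P, ∀ i, w.Walkable ((O 0 ω).2 i))
    (hindep : Pairwise fun i j => IndepFun (O i) (O j) P)
    (hident : ∀ j, IdentDistrib (O j) (O 0) P P) :
    ∀ᵐ ω ∂P, Tendsto (fun n : ℕ => (∑ j ∈ Finset.range n, minTime w sys (locSet (O j ω))) / n)
      atTop (𝓝 (∫ ω, minTime w sys (locSet (O 0 ω)) ∂P)) :=
  have hτ := measurable_minTime w sys
  strong_law_ae_real (fun j ω => minTime w sys (locSet (O j ω)))
    (integrable_minTime (hident 0).aemeasurable_fst hwalk)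
    (fun _ _ hij => (hindep hij).comp hτ hτ) fun j => (hident j).comp hτ

theorem ae_forall_eq_depot (hsys : sys ≠ .robot) {O : ℕ → Ω → OrderTuple}
    (hident : ∀ j, IdentDistrib (O j) (O 0) P P)
    (hzero : ∀ᵐ ω ∂P, minTime w sys (locSet (O 0 ω)) = 0) :
    ∀ᵐ ω ∂P, ∀ j i, (O j ω).2 i = w.depot := by
  have hall := ae_all_iff.2 fun j =>
    (hident j).symm.ae_snd (measurable_minTime w sys (measurableSet_singleton 0)) hzero
  filter_upwards [hall] with ω hω j i
  exact eq_depot_of_minTime_eq_zero hsys (hω j) (mem_locSet.2 ⟨i, rfl⟩)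

end Random

end OrderPicking

open OrderPicking in
theorem theorem1_general {Ω : Type*} [MeasurableSpace Ω] (P : Measure Ω) [IsProbabilityMeasure P]
    (w : Warehouse) (sys : PickingSystem) (c : ℕ) (hc : 1 ≤ c) (O : ℕ → Ω → OrderTuple)
    (Y : ℕ → Ω → ℝ)
    (hO_walk : ∀ j, ∀ᵐ ω ∂P, 1 ≤ (O j ω).1 ∧ ∀ i, w.Walkable ((O j ω).2 i))
    (hO_indep : Pairwise fun i j => IndepFun (O i) (O j) P)
    (hO_ident : ∀ j, IdentDistrib (O j) (O 0) P P)
    (hY_nonneg : ∀ j, ∀ᵐ ω ∂P, 0 ≤ Y j ω)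
    (hY_indep : Pairwise fun i j => IndepFun (Y i) (Y j) P)
    (hY_ident : ∀ j, IdentDistrib (Y j) (Y 0) P P) (hY_mean : Integrable (Y 0) P)
    (hK : sys = PickingSystem.robot → 1 < ∫⁻ ω, ((locSet (O 0 ω)).card : ℝ≥0∞) ∂P)
    (hnontriv : ¬ ∀ᵐ ω ∂P, Y 0 ω = 0 ∧ ∀ i, (O 0 ω).2 i = w.depot) :
    ∀ᵐ ω ∂P,
      (∀ n, ∃ T, IsReopt w sys c (mkInstance n (fun j => O j ω) (fun j => Y j ω)) T) ∧
      ∀ T : ℕ → ℝ,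
        (∀ n, IsReopt w sys c (mkInstance n (fun j => O j ω) (fun j => Y j ω)) (T n)) →
        Tendsto (fun n => T n / CIOPT w sys c (mkInstance n (fun j => O j ω) (fun j => Y j ω)))
          atTop (𝓝 1) := by
  have hO := ae_all_iff.2 hO_walk
  have hY := ae_all_iff.2 hY_nonneg
  have hY_lim := strong_law_ae_real Y hY_mean hY_indep hY_ident
  have hO_lim := ae_tendsto_sum_minTime (sys := sys) ((hO_walk 0).mono fun _ h => h.2)
    hO_indep hO_ident
  by_cases hzero : ∀ᵐ ω ∂P, minTime w sys (locSet (O 0 ω)) = 0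
  · have hsys : sys ≠ .robot := fun h => not_ae_card_le_one (hK h)
      (hzero.mono fun _ h0 => card_le_one_of_minTime_robot_eq_zero (h ▸ h0))
    have hdepot := ae_forall_eq_depot hsys hO_ident hzero
    have hY_pos := integral_pos_of_not_ae_eq_zero (hY_nonneg 0) hY_mean
      fun h => hnontriv (h.and (hdepot.mono fun _ h => h 0))
    filter_upwards [hO, hY, hY_lim, hdepot] with ω ho hy hlim hdepot
    exact ⟨exists_isReopt_mkInstance (fun j => (ho j).2) hc hy, fun T hT =>
      tendsto_reopt_div_ciopt_of_locs_eq_depot hdepot (fun j => (ho j).1) hc hy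
        (exists_pos_of_tendsto_sum_div hY_pos hlim) hT⟩
  · have hτ_pos := integral_pos_of_not_ae_eq_zero (.of_forall fun _ => minTime_nonneg _)
      (integrable_minTime (hO_ident 0).aemeasurable_fst ((hO_walk 0).mono fun _ h => h.2)) hzero
    filter_upwards [hO, hY, hY_lim, hO_lim] with ω ho hy hlim hτ_lim
    exact ⟨exists_isReopt_mkInstance (fun j => (ho j).2) hc hy, fun T hT =>
      tendsto_reopt_div_ciopt_of_tendsto_sum_minTime (fun j => (ho j).2) (fun j => (ho j).1) hc hy
        (isLittleO_of_tendsto_sum_div hlim) hτ_pos hτ_lim hT⟩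

theorem theorem1 {Ω : Type*} [MeasurableSpace Ω] (P : Measure Ω) [IsProbabilityMeasure P]
    (w : OrderPicking.Warehouse) (sys : OrderPicking.PickingSystem) (c : ℕ) (hc : 1 ≤ c)
    (O : ℕ → Ω → OrderPicking.OrderTuple) (Y : ℕ → Ω → ℝ)
    (hO_order : ∀ j, ∀ᵐ ω ∂P, OrderPicking.IsOrder w (O j ω))
    (hO_indep : iIndepFun O P) (hO_ident : ∀ j, IdentDistrib (O j) (O 0) P P)
    (hY_nonneg : ∀ j, ∀ᵐ ω ∂P, 0 ≤ Y j ω)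
    (hY_indep : iIndepFun Y P) (hY_ident : ∀ j, IdentDistrib (Y j) (Y 0) P P)
    (hY_mean : Integrable (Y 0) P)
    (hOY : IndepFun (fun ω j => O j ω) (fun ω j => Y j ω) P)
    (hK : sys = OrderPicking.PickingSystem.robot →
      1 < ∫⁻ ω, ((OrderPicking.locSet (O 0 ω)).card : ℝ≥0∞) ∂P)
    (hnontriv : ¬ ∀ᵐ ω ∂P, Y 0 ω = 0 ∧ ∀ i, (O 0 ω).2 i = w.depot) :
    ∀ᵐ ω ∂P,
      (∀ n, ∃ T, OrderPicking.IsReopt w sys c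
        (OrderPicking.mkInstance n (fun j => O j ω) (fun j => Y j ω)) T) ∧
      ∀ T : ℕ → ℝ,
        (∀ n, OrderPicking.IsReopt w sys c
          (OrderPicking.mkInstance n (fun j => O j ω) (fun j => Y j ω)) (T n)) →
        Tendsto (fun n => T n / OrderPicking.CIOPT w sys c
          (OrderPicking.mkInstance n (fun j => O j ω) (fun j => Y j ω))) atTop (𝓝 1) :=
  theorem1_general P w sys c hc O Y
    (fun j => (hO_order j).mono fun _ h => ⟨h.1, fun i => Or.inl (h.2 i)⟩)
    (fun _ _ hij => hO_indep.indepFun hij) hO_ident hY_nonneg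
    (fun _ _ hij => hY_indep.indepFun hij) hY_ident hY_mean hK hnontriv
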